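/- Let $(S,d)$ be a complete separable metric space, let $\Lambda$ be Lebesgue measure on $[0,\infty)$, and let $h_1,h_2,\ldots$ be continuous functions on $S$ with $0\le h_k\le 1$ and $\bigcup_k\{x: h_k(x)>0\}=S$. Let $\mathcal M_{\{h_k\}}(S)$ be the set of Borel measures $\nu$ on $S$ with $\int_S h_k\,d\nu<\infty$ for all $k$, with the coarsest topology for which $\nu\mapsto\int_S f h_k\,d\nu$ is continuous for every $k$ and every bounded continuous $f$ on $S$. Let $\mathcal M_{\{h_k\}}(S\times[0,\infty))$ be the set of Borel measures $\mu$ on $S\times[0,\infty)$ with $\int_{S\times[0,K]}h_k(x)\,\mu(dx\times du)<\infty$ for all $k$ and $K>0$, with the coarsest topology for which $\mu\mapsto\int f(x,u)h_k(x)\,\mu(dx\times du)$ is continuous for every $k$ and every bounded continuous $f$ on $S\times[0,\infty)$ supported in $S\times[0,K]$ for some $K>0$. Both spaces carry their Borel $\sigma$-algebras. A Poisson random measure with ($\sigma$-finite) mean measure $\nu$ is a random counting measure $N$ such that $N(A)$ is Poisson distributed with parameter $\nu(A)$ whenever $\nu(A)<\infty$, and $N(A_1),N(A_2),\ldots$ are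 independent for disjoint measurable $A_1,A_2,\ldots$. For random elements $\xi$ of $\mathcal M_{\{h_k\}}(S\times[0,\infty))$ and $\Xi$ of $\mathcal M_{\{h_k\}}(S)$ on one probability space, $\xi$ is conditionally Poisson with Cox measure $\Xi\times\Lambda$ if, conditioned on $\Xi$, $\xi$ is a Poisson random measure with mean measure $\Xi\times\Lambda$. If only the laws of $\xi$ and $\Xi$ are given, this means that some coupling of the two laws has this property. For $n=1,2,\ldots$ let $\xi^n$, with values in $\mathcal M_{\{h_k\}}(S\times[0,\infty))$, be conditionally Poisson with Cox measure $\Xi^n\times\Lambda$, where $\Xi^n$ has values in $\mathcal M_{\{h_k\}}(S)$. Then: 1. $(\xi^n)$ converges in distribution in $\mathcal M_{\{h_k\}}(S\times[0,\infty))$ if and only if $(\Xi^n)$ converges in distribution in $\mathcal M_{\{h_k\}}(S)$. 2. If $\xi^n\Rightarrow\xi$ and $\Xi^n\Rightarrow\Xi$, then $\xi$ is conditionally Poisson with Cox measure $\Xi\times\Lambda$ (in the sense of laws). 3. If $\xi$ is conditionally Poisson with Cox measure $\Xi\times\Lambda$ (in the sense of laws), then $\xi^n\Rightarrow\xi$ if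 and only if $\Xi^n\Rightarrow\Xi$. -/

import Mathlib

open MeasureTheory ProbabilityTheory Filter Topology
open scoped ENNReal NNReal BoundedContinuousFunction

noncomputable section

/-- Lebesgue measure on `[0, ∞)`. -/
def lebesgueHalfLine : Measure ℝ≥0 :=
  Measure.comap (fun u : ℝ≥0 => (u : ℝ)) volume

section MeasureSpaces

variable {S : Type*} [TopologicalSpace S] [MeasurableSpace S]

/-- The Borel measures `ν` on `S` with `∫ h_k dν < ∞` for all `k`. -/
def MBase (h : ℕ → S →ᵇ ℝ) : Type _ :=
  {ν : Measure S // ∀ k, ∫⁻ x, ENNReal.ofReal (h k x) ∂ν < ∞}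

/-- The Borel measures `μ` on `S × [0, ∞)` with `∫_{S × [0, K]} h_k dμ < ∞` for all `k` and `K`. -/
def MStrip (h : ℕ → S →ᵇ ℝ) : Type _ :=
  {μ : Measure (S × ℝ≥0) //
    ∀ (k : ℕ) (K : ℝ≥0), ∫⁻ p in Set.univ ×ˢ Set.Iic K, ENNReal.ofReal (h k p.1) ∂μ < ∞}

/-- Bounded continuous functions on `S × [0, ∞)` vanishing outside some `S × [0, K]`. -/
def StripTest (S : Type*) [TopologicalSpace S] : Type _ :=
  {f : (S × ℝ≥0) →ᵇ ℝ // ∃ K : ℝ≥0, ∀ (x : S) (u : ℝ≥0), K < u → f (x, u) = 0}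

/-- The coarsest topology for which `ν ↦ ∫ f h_k dν` is continuous for all `k` and all bounded
continuous `f`. -/
instance MBase.topologicalSpace (h : ℕ → S →ᵇ ℝ) : TopologicalSpace (MBase h) :=
  TopologicalSpace.induced
    (fun (ν : MBase h) (q : ℕ × (S →ᵇ ℝ)) => ∫ x, q.2 x * h q.1 x ∂ν.1) inferInstance

/-- The coarsest topology for which `μ ↦ ∫ f h_k dμ` is continuous for all `k` and all bounded
continuous `f` supported in some `S × [0, K]`. -/
instance MStrip.topologicalSpace (h : ℕ → S →ᵇ ℝ) : TopologicalSpace (MStrip h) :=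
  TopologicalSpace.induced
    (fun (μ : MStrip h) (q : ℕ × StripTest S) => ∫ p, q.2.1 p * h q.1 p.1 ∂μ.1) inferInstance

instance MBase.measurableSpace (h : ℕ → S →ᵇ ℝ) : MeasurableSpace (MBase h) :=
  borel (MBase h)

instance MStrip.measurableSpace (h : ℕ → S →ᵇ ℝ) : MeasurableSpace (MStrip h) :=
  borel (MStrip h)

instance MBase.borelSpace (h : ℕ → S →ᵇ ℝ) : BorelSpace (MBase h) := ⟨rfl⟩

instance MStrip.borelSpace (h : ℕ → S →ᵇ ℝ) : BorelSpace (MStrip h) := ⟨rfl⟩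

end MeasureSpaces

/-- Under the probability measure `P`, `N` is a Poisson random measure with mean measure `ν`. -/
structure IsPoissonRandomMeasure {Ω X : Type*} [MeasurableSpace Ω] [MeasurableSpace X]
    (P : Measure Ω) (N : Ω → Measure X) (ν : Measure X) : Prop where
  /-- `N` is almost surely a counting measure, that is, has values in `{0, 1, 2, …, ∞}`. -/
  counting : ∀ᵐ ω ∂P, ∀ A, MeasurableSet A → ∃ n : ℕ∞, N ω A = (n : ℝ≥0∞)
  /-- `N A` is Poisson distributed with parameter `ν A` whenever `ν A < ∞`. -/
  poisson : ∀ A, MeasurableSet A → ν A < ∞ →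
    P.map (fun ω => N ω A) =
      (poissonMeasure (ν A).toNNReal).map (fun n : ℕ => (n : ℝ≥0∞))
  /-- `N A₁, N A₂, …` are independent for disjoint `A₁, A₂, …`. -/
  indep : ∀ A : ℕ → Set X, (∀ i, MeasurableSet (A i)) → Pairwise (Function.onFun Disjoint A) →
    iIndepFun (fun i ω => N ω (A i)) P

section Cox

variable {S : Type*} [TopologicalSpace S] [MeasurableSpace S]

/-- `ξ` is conditionally Poisson with Cox measure `Ξ × Λ` (`Λ` Lebesgue measure on `[0, ∞)`):
there is a regular conditional distribution `κ` of `ξ` given `Ξ` such that, for almost every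
value `ν` of `Ξ`, `κ ν` is the law of a Poisson random measure with mean measure `ν × Λ`. -/
def IsConditionallyPoisson {Ω : Type*} [MeasurableSpace Ω] (P : Measure Ω) {h : ℕ → S →ᵇ ℝ}
    (ξ : Ω → MStrip h) (Ξ : Ω → MBase h) : Prop :=
  AEMeasurable ξ P ∧ AEMeasurable Ξ P ∧
    ∃ κ : Kernel (MBase h) (MStrip h), IsMarkovKernel κ ∧
      P.map (fun ω => (Ξ ω, ξ ω)) = (P.map Ξ) ⊗ₘ κ ∧
      ∀ᵐ ν ∂(P.map Ξ),
        IsPoissonRandomMeasure (κ ν) (fun μ : MStrip h => μ.1) (ν.1.prod lebesgueHalfLine)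

/-- The version of `IsConditionallyPoisson` for random measures of which only the laws
`Q` (of `ξ`) and `R` (of `Ξ`) are given: some coupling of `R` and `Q` is conditionally Poisson. -/
def IsConditionallyPoissonLaw {h : ℕ → S →ᵇ ℝ}
    (Q : Measure (MStrip h)) (R : Measure (MBase h)) : Prop :=
  ∃ ρ : Measure (MBase h × MStrip h),
    ρ.map Prod.fst = R ∧ ρ.map Prod.snd = Q ∧ IsConditionallyPoisson ρ Prod.snd Prod.fst

end Cox

end

/-!
Test functions enter through the cone generated by the products `φ h_k`, `φ ≥ 0`: convergence in
distribution is equivalent to convergence of the Laplace functionals `E exp (-∫ ψ dΞ)` over this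
cone, because the maps `ν ↦ exp (-∫ ψ dν)` are closed under multiplication and generate the
topology. If `ξ` is conditionally Poisson with Cox measure `Ξ × Λ`, then
`E exp (-∫ f dξ) = E exp (-∫ ψ dΞ)` with `ψ x = ∫ (1 - exp (-f (x, u))) du`. This `ψ` lies in the
cone whenever `f` does, and conversely every `ψ` arises, from `f = -log (1 - g)` with
`g (x, u) = c ψ x χ u` for a cutoff function `χ` so spread out that `g ≤ 1 / 2`. Hence the Laplace
functionals of `ξ n` converge if and only if those of `Ξ n` do. If the `ξ n` converge, the limit
of the Laplace functionals of `Ξ n` is moreover continuous at zero, which makes the laws of `Ξ n`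
tight and so yields a limit; if the `Ξ n` converge, the limit of the `ξ n` is obtained by mixing
Poisson laws.
-/

noncomputable section

section ConvergenceDetermining

variable {E F : Type*} [TopologicalSpace E] [MeasurableSpace E] [BorelSpace E]
  [TopologicalSpace F] [MeasurableSpace F] [BorelSpace F] {ι : Type*} {L : Filter ι}

lemma tendsto_integral_of_mem_adjoin (M : Submonoid (E →ᵇ ℝ)) {m : ι → Measure E}
    {m₀ : Measure E} [∀ i, IsFiniteMeasure (m i)] [IsFiniteMeasure m₀]
    (hM : ∀ f ∈ M, Tendsto (fun i => ∫ x, f x ∂m i) L (𝓝 (∫ x, f x ∂m₀)))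
    {f : E →ᵇ ℝ} (hf : f ∈ Algebra.adjoin ℝ (M : Set (E →ᵇ ℝ))) :
    Tendsto (fun i => ∫ x, f x ∂m i) L (𝓝 (∫ x, f x ∂m₀)) := by
  have hf' : f ∈ Submodule.span ℝ (M : Set (E →ᵇ ℝ)) := by
    rwa [← Subalgebra.mem_toSubmodule, Algebra.adjoin_eq_span, Submonoid.closure_eq] at hf
  clear hf
  induction hf' using Submodule.span_induction with
  | mem f hf => exact hM f hf
  | zero => simpa using tendsto_const_nhds
  | add f g _ _ hf hg =>
    simp only [BoundedContinuousFunction.coe_add, Pi.add_apply,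
      integral_add (f.integrable _) (g.integrable _)]
    exact hf.add hg
  | smul a f _ hf =>
    simp only [BoundedContinuousFunction.coe_smul, smul_eq_mul, integral_const_mul]
    exact hf.const_mul a

lemma tendsto_of_isTightMeasureSet_of_submonoid [PolishSpace F] (M : Submonoid (F →ᵇ ℝ))
    (hsep : ∀ x y, x ≠ y → ∃ f ∈ M, f x ≠ f y) {Q : ι → ProbabilityMeasure F}
    {Q₀ : ProbabilityMeasure F} (htight : IsTightMeasureSet {(Q i : Measure F) | i})
    (hM : ∀ f ∈ M, Tendsto (fun i => ∫ x, f x ∂(Q i : Measure F)) L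
      (𝓝 (∫ x, f x ∂(Q₀ : Measure F)))) :
    Tendsto Q L (𝓝 Q₀) := by
  let A : StarSubalgebra ℝ (F →ᵇ ℝ) :=
    { Algebra.adjoin ℝ (M : Set (F →ᵇ ℝ)) with
      star_mem' := fun {f} hf => by
        have : star f = f := by ext x; simp
        rwa [this] }
  refine ProbabilityMeasure.tendsto_of_tight_of_separatesPoints ℝ htight (A := A) ?_
    fun f hf => tendsto_integral_of_mem_adjoin M hM hf
  intro x y hxy
  obtain ⟨f, hf, hfxy⟩ := hsep x y hxy
  exact ⟨_, ⟨_, ⟨f, Algebra.subset_adjoin hf, rfl⟩, rfl⟩, hfxy⟩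

lemma tendsto_of_tendsto_map_of_isInducing [HasOuterApproxClosed F] [L.IsCountablyGenerated]
    {e : E → F} (he : IsInducing e) {Q : ι → ProbabilityMeasure E} {Q₀ : ProbabilityMeasure E}
    (hQ : Tendsto (fun i => (Q i).map he.continuous.measurable.aemeasurable) L
      (𝓝 (Q₀.map he.continuous.measurable.aemeasurable))) :
    Tendsto Q L (𝓝 Q₀) := by
  refine tendsto_of_forall_isOpen_le_liminf' fun G hG => ?_
  obtain ⟨V, hV, rfl⟩ := he.isOpen_iff.mp hG
  simpa only [ProbabilityMeasure.toMeasure_map,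
    Measure.map_apply he.continuous.measurable hV.measurableSet]
    using ProbabilityMeasure.le_liminf_measure_open_of_tendsto hQ hV

/-- The Hilbert cube is compact, so that after embedding into it tightness comes for free. -/
theorem tendsto_of_isInducing_of_submonoid [L.IsCountablyGenerated] {κ : Type*} [Countable κ]
    (M : Submonoid (E →ᵇ ℝ)) (g : κ → E →ᵇ ℝ) (hgM : ∀ k, g k ∈ M)
    (hg : ∀ k x, g k x ∈ Set.Icc (0 : ℝ) 1) (hind : IsInducing fun x k => g k x)
    {Q : ι → ProbabilityMeasure E} {Q₀ : ProbabilityMeasure E}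
    (hM : ∀ f ∈ M, Tendsto (fun i => ∫ x, f x ∂(Q i : Measure E)) L
      (𝓝 (∫ x, f x ∂(Q₀ : Measure E)))) :
    Tendsto Q L (𝓝 Q₀) := by
  let e : E → κ → unitInterval := fun x k => ⟨g k x, hg k x⟩
  have he : IsInducing e :=
    .of_comp (g := fun (y : κ → unitInterval) k => (y k : ℝ)) (by fun_prop) (by fun_prop) hind
  have hem (R : Measure E) : AEMeasurable e R := he.continuous.measurable.aemeasurable
  let N : Submonoid ((κ → unitInterval) →ᵇ ℝ) :=
    { carrier := {f | f.compContinuous ⟨e, he.continuous⟩ ∈ M}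
      one_mem' := M.one_mem
      mul_mem' := fun hf hf' => M.mul_mem hf hf' }
  refine tendsto_of_tendsto_map_of_isInducing he (tendsto_of_isTightMeasureSet_of_submonoid N
    (fun x y hxy => ?_) IsTightMeasureSet.of_compactSpace fun f hf => ?_)
  · obtain ⟨k, hk⟩ := Function.ne_iff.mp hxy
    exact ⟨BoundedContinuousFunction.mkOfCompact ⟨fun y => (y k : ℝ), by fun_prop⟩, hgM k,
      fun h => hk (Subtype.ext h)⟩
  · simpa only [ProbabilityMeasure.toMeasure_map,
      integral_map (hem _) f.continuous.aestronglyMeasurable,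
      BoundedContinuousFunction.compContinuous_apply, ContinuousMap.coe_mk] using hM _ hf

end ConvergenceDetermining

section FiniteMeasures

variable {X : Type*} [TopologicalSpace X]

lemma countable_closure_range {M κ : Type*} [Monoid M] [Countable κ] (g : κ → M) :
    (Submonoid.closure (Set.range g) : Set M).Countable := by
  have : Countable (FreeMonoid κ) := inferInstanceAs (Countable (List κ))
  rw [← FreeMonoid.mrange_lift]
  exact Set.countable_range _

variable (X) in
lemma exists_countable_submonoid_isInducing [SecondCountableTopology X]
    [TopologicalSpace.MetrizableSpace X] :
    ∃ M : Submonoid (X →ᵇ ℝ), Countable M ∧ (∀ f ∈ M, ∀ x, f x ∈ Set.Icc (0 : ℝ) 1) ∧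
      IsInducing fun x (f : M) => f.1 x := by
  let := TopologicalSpace.metrizableSpaceMetric X
  obtain ⟨e, he⟩ := Metric.PiNatEmbed.exists_embedding_to_hilbert_cube (X := X)
  let g : ℕ → X →ᵇ ℝ := fun k => .ofNormedAddCommGroup (fun x => (e x k : ℝ))
    (by have := he.continuous; fun_prop) 1 fun x => by
      rw [Real.norm_of_nonneg (e x k).2.1]; exact (e x k).2.2
  have hmem (k) : g k ∈ Submonoid.closure (Set.range g) := Submonoid.subset_closure ⟨k, rfl⟩
  refine ⟨Submonoid.closure (Set.range g), (countable_closure_range g).to_subtype,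
    fun f hf x => ?_, ?_⟩
  · induction hf using Submonoid.closure_induction with
    | mem f hf => obtain ⟨k, rfl⟩ := hf; exact (e x k).2
    | one => simp
    | mul f f' _ _ hf hf' => exact unitInterval.mul_mem hf hf'
  · have hg : IsInducing fun x k => g k x :=
      (IsInducing.piMap fun _ => IsInducing.subtypeVal).comp he.isInducing
    exact .of_comp (g := fun (y : Submonoid.closure (Set.range g) → ℝ) k => y ⟨g k, hmem k⟩)
      (by fun_prop) (by fun_prop) hg

variable [MeasurableSpace X] [BorelSpace X]

lemma tendsto_finiteMeasure_of_isInducing_of_submonoid {ι : Type*} {L : Filter ι}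
    [L.IsCountablyGenerated] (M : Submonoid (X →ᵇ ℝ)) [Countable M]
    (hM01 : ∀ f ∈ M, ∀ x, f x ∈ Set.Icc (0 : ℝ) 1) (hind : IsInducing fun x (f : M) => f.1 x)
    {m : ι → FiniteMeasure X} {m₀ : FiniteMeasure X}
    (hM : ∀ f ∈ M, Tendsto (fun i => ∫ x, f x ∂(m i : Measure X)) L
      (𝓝 (∫ x, f x ∂(m₀ : Measure X)))) :
    Tendsto m L (𝓝 m₀) := by
  have hmass : Tendsto (fun i => (m i).mass) L (𝓝 m₀.mass) := by
    rw [← NNReal.tendsto_coe]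
    simpa [FiniteMeasure.mass] using hM 1 M.one_mem
  rcases eq_or_ne m₀ 0 with rfl | hm₀
  · exact FiniteMeasure.tendsto_zero_of_tendsto_zero_mass (by simpa using hmass)
  have : Nonempty X := by
    by_contra! hX
    exact hm₀ (Subtype.ext (Measure.eq_zero_of_isEmpty _))
  refine FiniteMeasure.tendsto_of_tendsto_normalize_testAgainstNN_of_tendsto_mass
    (tendsto_of_isInducing_of_submonoid M (fun f : M => f.1) (fun f => f.2)
      (fun f => hM01 f.1 f.2) hind fun f hf => ?_) hmass
  have hmass₀ : m₀.mass ≠ 0 := m₀.mass_nonzero_iff.mpr hm₀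
  have hnorm {n : FiniteMeasure X} (hn : n.mass ≠ 0) :
      ∫ x, f x ∂(n.normalize : Measure X) = (n.mass : ℝ)⁻¹ * ∫ x, f x ∂(n : Measure X) := by
    rw [← n.average_eq_integral_normalize (n.mass_nonzero_iff.mp hn), average_eq]
    rfl
  rw [hnorm hmass₀]
  refine Tendsto.congr' ?_ ((((NNReal.tendsto_coe.mpr hmass).inv₀ (by simpa using hmass₀)).mul
    (hM f hf)))
  filter_upwards [hmass.eventually_ne hmass₀] with i hi
  rw [hnorm hi]

variable (X) in
theorem exists_isInducing_integral [SecondCountableTopology X]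
    [TopologicalSpace.MetrizableSpace X] :
    ∃ φ : ℕ → X →ᵇ ℝ, (∀ i x, 0 ≤ φ i x) ∧
      IsInducing fun (m : FiniteMeasure X) i => ∫ x, φ i x ∂(m : Measure X) := by
  obtain ⟨M, hMc, hM01, hind⟩ := exists_countable_submonoid_isInducing X
  obtain ⟨φ, hφ⟩ := exists_surjective_nat M
  let I (m : FiniteMeasure X) (i : ℕ) : ℝ := ∫ x, (φ i).1 x ∂(m : Measure X)
  have hI : Continuous I := continuous_pi fun i =>
    FiniteMeasure.continuous_integral_boundedContinuousFunction (φ i).1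
  have hle (m : FiniteMeasure X) : comap I (𝓝 (I m)) ≤ 𝓝 m :=
    tendsto_id'.mp (tendsto_finiteMeasure_of_isInducing_of_submonoid M hM01 hind fun f hf => by
      obtain ⟨i, hi⟩ := hφ ⟨f, hf⟩
      simpa only [I, hi, id_eq] using
        tendsto_pi_nhds.mp (tendsto_comap (f := I) (x := 𝓝 (I m))) i)
  exact ⟨fun i => φ i, fun i x => (hM01 _ (φ i).2 x).1,
    isInducing_iff_nhds.mpr fun m => le_antisymm hI.continuousAt.le_comap (hle m)⟩

end FiniteMeasures

section TestCone

variable {X : Type*} [TopologicalSpace X]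

/-- The cone of finite sums of functions `φ * h k` with `φ` nonnegative, bounded and continuous;
these are the functions at which Laplace functionals of random elements of `MBase h` are
evaluated. -/
def testCone (h : ℕ → X →ᵇ ℝ) : AddSubmonoid (X →ᵇ ℝ) :=
  AddSubmonoid.closure {ψ | ∃ (k : ℕ) (φ : X →ᵇ ℝ), (∀ x, 0 ≤ φ x) ∧ ψ = φ * h k}

variable {h : ℕ → X →ᵇ ℝ}

lemma mul_weight_mem_testCone (k : ℕ) {φ : X →ᵇ ℝ} (hφ : ∀ x, 0 ≤ φ x) :
    φ * h k ∈ testCone h :=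
  AddSubmonoid.subset_closure ⟨k, φ, hφ, rfl⟩

lemma mul_mem_testCone {φ ψ : X →ᵇ ℝ} (hφ : ∀ x, 0 ≤ φ x) (hψ : ψ ∈ testCone h) :
    φ * ψ ∈ testCone h := by
  induction hψ using AddSubmonoid.closure_induction with
  | mem ψ hψ =>
    obtain ⟨k, f, hf, rfl⟩ := hψ
    rw [← mul_assoc]
    exact mul_weight_mem_testCone k fun x => mul_nonneg (hφ x) (hf x)
  | zero => rw [mul_zero]; exact zero_mem _
  | add x y _ _ hx hy => rw [mul_add]; exact add_mem hx hy

lemma nonneg_of_mem_testCone (h0 : ∀ k x, 0 ≤ h k x) {ψ : X →ᵇ ℝ} (hψ : ψ ∈ testCone h) (x : X) :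
    0 ≤ ψ x := by
  induction hψ using AddSubmonoid.closure_induction with
  | mem ψ hψ =>
    obtain ⟨k, f, hf, rfl⟩ := hψ
    exact mul_nonneg (hf x) (h0 k x)
  | zero => exact le_rfl
  | add f g _ _ hf hg => exact add_nonneg hf hg

end TestCone

lemma measurable_measure_of_lintegral {α X : Type*} [MeasurableSpace α] [TopologicalSpace X]
    [HasOuterApproxClosed X] [MeasurableSpace X] [BorelSpace X] {κ : α → Measure X}
    [∀ a, IsFiniteMeasure (κ a)]
    (hκ : ∀ f : X →ᵇ ℝ≥0, Measurable fun a => ∫⁻ x, f x ∂κ a) : Measurable κ := by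
  refine Measurable.measure_of_isPiSystem (S := {s | IsClosed s})
    (BorelSpace.measurable_eq.trans borel_eq_generateFrom_isClosed) isPiSystem_isClosed ?_ ?_
  · intro F (hF : IsClosed F)
    refine measurable_of_tendsto_metrizable (fun n => hκ (hF.apprSeq n))
      (tendsto_pi_nhds.mpr fun a => ?_)
    exact measure_of_cont_bdd_of_tendsto_indicator (κ a) hF.measurableSet hF.apprSeq
      (HasOuterApproxClosed.apprSeq_apply_le_one hF) (HasOuterApproxClosed.tendsto_apprSeq hF)
  · simpa using hκ 1

lemma integral_withDensity_ofReal {X : Type*} [MeasurableSpace X] {g : X → ℝ} (hg : Measurable g)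
    (hg0 : ∀ x, 0 ≤ g x) (μ : Measure X) (f : X → ℝ) :
    ∫ x, f x ∂μ.withDensity (fun x => ENNReal.ofReal (g x)) = ∫ x, f x * g x ∂μ := by
  rw [integral_withDensity_eq_integral_toReal_smul (by fun_prop) (by simp)]
  simp only [ENNReal.toReal_ofReal (hg0 _), smul_eq_mul, mul_comm]

namespace MBase

section Laplace

variable {X : Type*} [TopologicalSpace X] [MeasurableSpace X] {h : ℕ → X →ᵇ ℝ}

lemma continuous_integral_mul_weight (k : ℕ) (f : X →ᵇ ℝ) :
    Continuous fun ν : MBase h => ∫ x, f x * h k x ∂ν.1 := by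
  have hcont : Continuous fun (ν : MBase h) (q : ℕ × (X →ᵇ ℝ)) => ∫ x, q.2 x * h q.1 x ∂ν.1 :=
    continuous_induced_dom
  exact (continuous_apply (k, f)).comp hcont

variable [OpensMeasurableSpace X]

lemma integrable_weight (h0 : ∀ k x, 0 ≤ h k x) (ν : MBase h) (k : ℕ) :
    Integrable (h k) ν.1 := by
  refine ⟨(h k).continuous.aestronglyMeasurable, ?_⟩
  rw [hasFiniteIntegral_iff_ofReal (Eventually.of_forall (h0 k))]
  exact ν.2 k

lemma integrable_of_mem_testCone (h0 : ∀ k x, 0 ≤ h k x) (ν : MBase h) {ψ : X →ᵇ ℝ}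
    (hψ : ψ ∈ testCone h) : Integrable ψ ν.1 := by
  induction hψ using AddSubmonoid.closure_induction with
  | mem ψ hψ =>
    obtain ⟨k, f, _, rfl⟩ := hψ
    exact (ν.integrable_weight h0 k).bdd_mul (c := ‖f‖) f.continuous.aestronglyMeasurable
      (Eventually.of_forall f.norm_coe_le_norm)
  | zero => exact integrable_zero _ _ _
  | add f g _ _ hf hg => exact hf.add hg

lemma continuous_integral_of_mem_testCone (h0 : ∀ k x, 0 ≤ h k x) {ψ : X →ᵇ ℝ}
    (hψ : ψ ∈ testCone h) : Continuous fun ν : MBase h => ∫ x, ψ x ∂ν.1 := by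
  induction hψ using AddSubmonoid.closure_induction with
  | mem ψ hψ =>
    obtain ⟨k, f, _, rfl⟩ := hψ
    exact continuous_integral_mul_weight k f
  | zero => simpa using continuous_const
  | add f g hf' hg' hf hg =>
    simp only [BoundedContinuousFunction.coe_add, Pi.add_apply, integral_add
      (integrable_of_mem_testCone h0 _ hf') (integrable_of_mem_testCone h0 _ hg')]
    exact hf.add hg

/-- The integrand `ν ↦ exp (-∫ ψ dν)` of the Laplace functional of a random element of
`MBase h`. -/
def laplace (h0 : ∀ k x, 0 ≤ h k x) (ψ : testCone h) : MBase h →ᵇ ℝ :=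
  BoundedContinuousFunction.ofNormedAddCommGroup (fun ν => Real.exp (-∫ x, ψ.1 x ∂ν.1))
    (Real.continuous_exp.comp (continuous_integral_of_mem_testCone h0 ψ.2).neg) 1 (fun ν => by
      rw [Real.norm_of_nonneg (Real.exp_pos _).le, Real.exp_le_one_iff, neg_nonpos]
      exact integral_nonneg (nonneg_of_mem_testCone h0 ψ.2))

@[simp] lemma laplace_apply (h0 : ∀ k x, 0 ≤ h k x) (ψ : testCone h) (ν : MBase h) :
    laplace h0 ψ ν = Real.exp (-∫ x, ψ.1 x ∂ν.1) := rfl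

lemma laplace_mem_Icc (h0 : ∀ k x, 0 ≤ h k x) (ψ : testCone h) (ν : MBase h) :
    laplace h0 ψ ν ∈ Set.Icc (0 : ℝ) 1 := by
  refine ⟨(Real.exp_pos _).le, ?_⟩
  rw [laplace_apply, Real.exp_le_one_iff, neg_nonpos]
  exact integral_nonneg (nonneg_of_mem_testCone h0 ψ.2)

/-- The multiplicative family of all functions `laplace h0 ψ`. -/
def laplaceMonoid (h0 : ∀ k x, 0 ≤ h k x) : Submonoid (MBase h →ᵇ ℝ) where
  carrier := Set.range (laplace h0)
  one_mem' := ⟨0, by ext ν; simp⟩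
  mul_mem' := by
    rintro _ _ ⟨φ, rfl⟩ ⟨ψ, rfl⟩
    refine ⟨φ + ψ, ?_⟩
    ext ν
    simp only [laplace_apply, BoundedContinuousFunction.coe_mul, Pi.mul_apply, AddSubmonoid.coe_add,
      BoundedContinuousFunction.coe_add, Pi.add_apply]
    rw [integral_add (integrable_of_mem_testCone h0 ν φ.2) (integrable_of_mem_testCone h0 ν ψ.2),
      neg_add, Real.exp_add]

end Laplace

section Weighted

variable {X : Type*} [TopologicalSpace X] [MeasurableSpace X] {h : ℕ → X →ᵇ ℝ}

/-- The finite measure with density `h k` with respect to `ν`. -/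
def weighted (ν : MBase h) (k : ℕ) : Measure X :=
  ν.1.withDensity fun x => ENNReal.ofReal (h k x)

instance (ν : MBase h) (k : ℕ) : IsFiniteMeasure (ν.weighted k) :=
  isFiniteMeasure_withDensity (ν.2 k).ne

/-- The sequence of all `ν.weighted k` as a point of a product of spaces of finite measures; this
identifies `MBase h` with a closed subspace of the product. -/
def toFiniteMeasures (ν : MBase h) (k : ℕ) : FiniteMeasure X := ⟨ν.weighted k, inferInstance⟩

variable [OpensMeasurableSpace X]

lemma integral_weighted (h0 : ∀ k x, 0 ≤ h k x) (ν : MBase h) (k : ℕ) (f : X → ℝ) :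
    ∫ x, f x ∂ν.weighted k = ∫ x, f x * h k x ∂ν.1 :=
  integral_withDensity_ofReal (h k).continuous.measurable (h0 k) ν.1 f

lemma integral_toFiniteMeasures (h0 : ∀ k x, 0 ≤ h k x) (ν : MBase h) (k : ℕ) (f : X → ℝ) :
    ∫ x, f x ∂(ν.toFiniteMeasures k : Measure X) = ∫ x, f x * h k x ∂ν.1 :=
  integral_weighted h0 ν k f

lemma isInducing_toFiniteMeasures (h0 : ∀ k x, 0 ≤ h k x) :
    IsInducing (toFiniteMeasures (h := h)) := by
  refine isInducing_iff_nhds.mpr fun ν => le_antisymm (tendsto_iff_comap.mp ?_) ?_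
  · refine tendsto_pi_nhds.mpr fun k => ?_
    refine FiniteMeasure.tendsto_iff_forall_integral_tendsto.mpr fun f => ?_
    simp only [integral_toFiniteMeasures h0]
    exact (continuous_integral_mul_weight k f).continuousAt
  · rw [nhds_induced, ← tendsto_iff_comap, tendsto_pi_nhds]
    rintro ⟨k, f⟩
    have hk := tendsto_pi_nhds.mp
      (tendsto_comap (f := toFiniteMeasures (h := h)) (x := 𝓝 ν.toFiniteMeasures)) k
    simpa only [integral_toFiniteMeasures h0] using
      FiniteMeasure.tendsto_iff_forall_integral_tendsto.mp hk f

end Weighted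

section Reconstruction

variable {X : Type*} [TopologicalSpace X] {h : ℕ → X →ᵇ ℝ}

/-- The points at which `k` is the first index with `h k > 0`. -/
def firstPos (h : ℕ → X →ᵇ ℝ) (k : ℕ) : Set X := disjointed (fun k => {x | 0 < h k x}) k

lemma pairwise_disjoint_firstPos : Pairwise (Function.onFun Disjoint (firstPos h)) :=
  disjoint_disjointed _

lemma iUnion_firstPos (hpos : ∀ x, ∃ k, 0 < h k x) : ⋃ k, firstPos h k = Set.univ := by
  rw [funext fun k => firstPos.eq_1 h k, iUnion_disjointed, Set.iUnion_eq_univ_iff]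
  exact hpos

lemma pos_of_mem_firstPos {k : ℕ} {x : X} (hx : x ∈ firstPos h k) : 0 < h k x :=
  disjointed_subset (fun k => {x | 0 < h k x}) k hx

variable [MeasurableSpace X] [OpensMeasurableSpace X]

lemma measurableSet_firstPos (k : ℕ) : MeasurableSet (firstPos h k) :=
  MeasurableSet.disjointed (fun k => (isOpen_lt continuous_const (h k).continuous).measurableSet) k

lemma sum_restrict_firstPos (hpos : ∀ x, ∃ k, 0 < h k x) (μ : Measure X) :
    Measure.sum (fun k => μ.restrict (firstPos h k)) = μ := by
  rw [← Measure.restrict_iUnion pairwise_disjoint_firstPos measurableSet_firstPos,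
    iUnion_firstPos hpos, Measure.restrict_univ]

/-- The measure recovered from its weighted versions `m k`: on the set where `k` is the first index
with `h k > 0`, it has density `(h k)⁻¹` with respect to `m k`. -/
def glue (h : ℕ → X →ᵇ ℝ) (m : ℕ → Measure X) : Measure X :=
  Measure.sum fun k => ((m k).restrict (firstPos h k)).withDensity
    fun x => (ENNReal.ofReal (h k x))⁻¹

lemma restrict_firstPos_withDensity_inv (μ : Measure X) (k : ℕ) :
    ((μ.withDensity fun x => ENNReal.ofReal (h k x)).restrict (firstPos h k)).withDensity
      (fun x => (ENNReal.ofReal (h k x))⁻¹) = μ.restrict (firstPos h k) := by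
  rw [restrict_withDensity (measurableSet_firstPos k)]
  refine withDensity_inv_same (by fun_prop) ?_ (by simp)
  filter_upwards [ae_restrict_mem (measurableSet_firstPos k)] with x hx
  simpa using pos_of_mem_firstPos hx

lemma glue_weighted (hpos : ∀ x, ∃ k, 0 < h k x) (ν : MBase h) : glue h ν.weighted = ν.1 := by
  simp only [glue, weighted, restrict_firstPos_withDensity_inv, sum_restrict_firstPos hpos]

lemma withDensity_glue (hpos : ∀ x, ∃ k, 0 < h k x) {m : ℕ → Measure X}
    (hm : ∀ j k, (m k).withDensity (fun x => ENNReal.ofReal (h j x))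
      = (m j).withDensity fun x => ENNReal.ofReal (h k x)) (j : ℕ) :
    (glue h m).withDensity (fun x => ENNReal.ofReal (h j x)) = m j := by
  rw [glue, withDensity_sum, ← sum_restrict_firstPos hpos (m j)]
  congr 1
  ext1 k
  rw [← restrict_firstPos_withDensity_inv (m j) k, ← hm j k,
    restrict_withDensity (measurableSet_firstPos k), ← withDensity_mul _ (by fun_prop)
    (by fun_prop), mul_comm, withDensity_mul _ (by fun_prop) (by fun_prop)]

lemma injective_toFiniteMeasures (hpos : ∀ x, ∃ k, 0 < h k x) :
    Function.Injective (toFiniteMeasures (h := h)) := by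
  refine fun ν ν' heq => Subtype.ext ?_
  rw [← glue_weighted hpos ν, ← glue_weighted hpos ν']
  congr 1
  ext1 k
  exact congrArg Subtype.val (congrFun heq k)

end Reconstruction

section ClosedEmbedding

variable {X : Type*} [TopologicalSpace X] [HasOuterApproxClosed X] [MeasurableSpace X]
  [BorelSpace X] {h : ℕ → X →ᵇ ℝ}

lemma mem_range_toFiniteMeasures_iff (h0 : ∀ k x, 0 ≤ h k x) (hpos : ∀ x, ∃ k, 0 < h k x)
    {m : ℕ → FiniteMeasure X} :
    m ∈ Set.range (toFiniteMeasures (h := h)) ↔ ∀ j k (f : X →ᵇ ℝ),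
      ∫ x, (f * h j) x ∂(m k : Measure X) = ∫ x, (f * h k) x ∂(m j : Measure X) := by
  constructor
  · rintro ⟨ν, rfl⟩ j k f
    rw [integral_toFiniteMeasures h0, integral_toFiniteMeasures h0]
    simp only [BoundedContinuousFunction.coe_mul, Pi.mul_apply, mul_right_comm]
  intro hm
  have hfin (μ : FiniteMeasure X) (j : ℕ) :
      IsFiniteMeasure ((μ : Measure X).withDensity fun x => ENNReal.ofReal (h j x)) :=
    isFiniteMeasure_withDensity_ofReal ((h j).integrable _).2
  have hsymm (j k) : (m k : Measure X).withDensity (fun x => ENNReal.ofReal (h j x))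
      = (m j : Measure X).withDensity fun x => ENNReal.ofReal (h k x) := by
    refine ext_of_forall_integral_eq_of_IsFiniteMeasure fun f => ?_
    rw [integral_withDensity_ofReal (h j).continuous.measurable (h0 j),
      integral_withDensity_ofReal (h k).continuous.measurable (h0 k)]
    exact hm j k f
  have hglue := withDensity_glue hpos hsymm
  refine ⟨⟨glue h fun k => m k, fun k => ?_⟩, funext fun k => Subtype.ext (hglue k)⟩
  rw [← setLIntegral_univ, ← withDensity_apply _ MeasurableSet.univ, hglue k]
  exact measure_lt_top _ _

lemma isClosedEmbedding_toFiniteMeasures (h0 : ∀ k x, 0 ≤ h k x) (hpos : ∀ x, ∃ k, 0 < h k x) :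
    IsClosedEmbedding (toFiniteMeasures (h := h)) := by
  refine ⟨⟨isInducing_toFiniteMeasures h0, injective_toFiniteMeasures hpos⟩, ?_⟩
  have hcont (j k : ℕ) (f : X →ᵇ ℝ) :
      Continuous fun m : ℕ → FiniteMeasure X => ∫ x, (f * h j) x ∂(m k : Measure X) :=
    (FiniteMeasure.continuous_integral_boundedContinuousFunction (f * h j)).comp
      (continuous_apply k)
  have hrange : Set.range (toFiniteMeasures (h := h)) = {m | ∀ j k (f : X →ᵇ ℝ),
      ∫ x, (f * h j) x ∂(m k : Measure X) = ∫ x, (f * h k) x ∂(m j : Measure X)} :=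
    Set.ext fun m => mem_range_toFiniteMeasures_iff h0 hpos
  simp only [hrange, Set.ofPred_forall]
  exact isClosed_iInter fun j => isClosed_iInter fun k => isClosed_iInter fun f =>
    isClosed_eq (hcont j k f) (hcont k j f)

lemma isCompact_setOf_weighted_le [T4Space X] (h0 : ∀ k x, 0 ≤ h k x)
    (hpos : ∀ x, ∃ k, 0 < h k x) (C : ℕ → ℝ≥0) {K : ℕ → ℕ → Set X}
    (hK : ∀ k j, IsCompact (K k j)) {u : ℕ → ℝ≥0} (hu : Tendsto u atTop (𝓝 0)) :
    IsCompact {ν : MBase h | ∀ k, ν.weighted k Set.univ ≤ C k ∧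
      ∀ j, ν.weighted k (K k j)ᶜ ≤ u j} := by
  have hcompact := (isClosedEmbedding_toFiniteMeasures h0 hpos).isCompact_preimage
    (isCompact_univ_pi fun k => isCompact_setOfPred_finiteMeasure_mass_le_compl_isCompact_le (C k)
      hu (hK k) (Or.inl inferInstance))
  convert hcompact using 1
  ext ν
  have hcoe (k : ℕ) (A : Set X) (c : ℝ≥0) :
      ν.weighted k A ≤ c ↔ ν.toFiniteMeasures k A ≤ c := by
    rw [← ENNReal.coe_le_coe, FiniteMeasure.ennreal_coeFn_eq_coeFn_toMeasure]
    rfl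
  simp only [Set.mem_ofPred_eq, Set.mem_preimage, Set.mem_pi, Set.mem_univ, true_imp_iff, hcoe]
  rfl

end ClosedEmbedding

section Measurability

variable {X : Type*} [TopologicalSpace X] [MeasurableSpace X] {h : ℕ → X →ᵇ ℝ}

lemma measurable_weighted [HasOuterApproxClosed X] [BorelSpace X] (h0 : ∀ k x, 0 ≤ h k x) (k : ℕ) :
    Measurable fun ν : MBase h => ν.weighted k := by
  refine measurable_measure_of_lintegral fun f => ?_
  let f' : X →ᵇ ℝ := f.comp (fun r : ℝ≥0 => (r : ℝ)) isometry_subtype_coe.lipschitz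
  have hint (ν : MBase h) :
      ∫⁻ x, f x ∂ν.weighted k = ENNReal.ofReal (∫ x, f' x * h k x ∂ν.1) := by
    rw [← integral_weighted h0 ν k, lintegral_coe_eq_integral]
    · rfl
    · exact f'.integrable _
  simp only [hint]
  exact (continuous_integral_mul_weight k f').measurable.ennreal_ofReal

lemma measurable_val [HasOuterApproxClosed X] [BorelSpace X] (h0 : ∀ k x, 0 ≤ h k x)
    (hpos : ∀ x, ∃ k, 0 < h k x) : Measurable fun ν : MBase h => ν.1 := by
  refine Measure.measurable_of_measurable_coe _ fun A hA => ?_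
  have hval (ν : MBase h) : ν.1 A =
      ∑' k, ∫⁻ x, (A ∩ firstPos h k).indicator (fun x => (ENNReal.ofReal (h k x))⁻¹) x
        ∂ν.weighted k := by
    rw [← glue_weighted hpos ν, glue, Measure.sum_apply _ hA]
    refine tsum_congr fun k => ?_
    rw [withDensity_apply _ hA, Measure.restrict_restrict hA,
      lintegral_indicator (hA.inter (measurableSet_firstPos k))]
  simp only [hval]
  refine Measurable.tsum fun k => (Measure.measurable_lintegral ?_).comp (measurable_weighted h0 k)
  exact Measurable.indicator (by fun_prop) (hA.inter (measurableSet_firstPos k))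

end Measurability

section Topology

variable {X : Type*} [TopologicalSpace X] [SecondCountableTopology X]
  [TopologicalSpace.MetrizableSpace X] [MeasurableSpace X] [BorelSpace X] {h : ℕ → X →ᵇ ℝ}

lemma exists_isInducing_laplace (h0 : ∀ k x, 0 ≤ h k x) :
    ∃ ψ : ℕ × ℕ → testCone h, IsInducing fun (ν : MBase h) q => laplace h0 (ψ q) ν := by
  obtain ⟨φ, hφ, hind⟩ := exists_isInducing_integral X
  refine ⟨fun q => ⟨φ q.2 * h q.1, mul_weight_mem_testCone q.1 (hφ q.2)⟩, ?_⟩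
  have hexp : IsInducing fun r : ℝ => Real.exp (-r) :=
    Real.isOpenEmbedding_exp.isInducing.comp (Homeomorph.neg ℝ).isInducing
  have hcomp := (IsInducing.piMap fun _ : ℕ × ℕ => hexp).comp <|
    (Homeomorph.piCurry (X := ℕ) (Y := ℕ) (Z := ℝ)).symm.isInducing.comp <|
      (IsInducing.piMap fun _ : ℕ => hind).comp (isInducing_toFiniteMeasures h0)
  convert hcomp using 3 with ν q
  exact congrArg (fun r => Real.exp (-r)) (integral_toFiniteMeasures h0 ν q.1 (φ q.2)).symm

theorem tendsto_of_laplace (h0 : ∀ k x, 0 ≤ h k x) {ι : Type*} {L : Filter ι}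
    [L.IsCountablyGenerated] {R : ι → ProbabilityMeasure (MBase h)}
    {R₀ : ProbabilityMeasure (MBase h)}
    (hR : ∀ ψ : testCone h, Tendsto (fun i => ∫ ν, laplace h0 ψ ν ∂(R i : Measure (MBase h))) L
      (𝓝 (∫ ν, laplace h0 ψ ν ∂(R₀ : Measure (MBase h))))) :
    Tendsto R L (𝓝 R₀) := by
  obtain ⟨ψ, hψ⟩ := exists_isInducing_laplace h0
  refine tendsto_of_isInducing_of_submonoid (laplaceMonoid h0) (fun q => laplace h0 (ψ q))
    (fun q => ⟨ψ q, rfl⟩) (fun q => laplace_mem_Icc h0 (ψ q)) hψ ?_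
  rintro _ ⟨φ, rfl⟩
  exact hR φ

lemma metrizableSpace (h0 : ∀ k x, 0 ≤ h k x) (hpos : ∀ x, ∃ k, 0 < h k x) :
    TopologicalSpace.MetrizableSpace (MBase h) := by
  obtain ⟨ψ, hψ⟩ := exists_isInducing_laplace h0
  have := hψ.pseudoMetrizableSpace
  have := (isClosedEmbedding_toFiniteMeasures h0 hpos).isEmbedding.t2Space
  exact ⟨⟩

lemma measurable_of_measurable_val (h0 : ∀ k x, 0 ≤ h k x) {Ω : Type*} [MeasurableSpace Ω]
    {Y : Ω → MBase h} (hY : Measurable fun ω => (Y ω).1) : Measurable Y := by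
  obtain ⟨ψ, hψ⟩ := exists_isInducing_laplace h0
  have hint (q : ℕ × ℕ) (ω : Ω) : ∫ x, (ψ q).1 x ∂(Y ω).1
      = (∫⁻ x, ENNReal.ofReal ((ψ q).1 x) ∂(Y ω).1).toReal :=
    integral_eq_lintegral_of_nonneg_ae
      (Eventually.of_forall (nonneg_of_mem_testCone h0 (ψ q).2))
      (ψ q).1.continuous.aestronglyMeasurable
  have hmeas : Measurable fun ω q => laplace h0 (ψ q) (Y ω) := by
    refine measurable_pi_iff.mpr fun q => Real.measurable_exp.comp (Measurable.neg ?_)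
    simp only [hint]
    exact ((Measure.measurable_lintegral (by fun_prop)).comp hY).ennreal_toReal
  refine measurable_of_isOpen fun U hU => ?_
  obtain ⟨V, hV, rfl⟩ := hψ.isOpen_iff.mp hU
  exact hmeas hV.measurableSet

end Topology

end MBase

lemma exists_antitone_tendsto_zero_mem_thickening (X : Type*) [PseudoMetricSpace X]
    [TopologicalSpace.SeparableSpace X] {r : ℝ} (hr : 0 < r) :
    ∃ φ : ℕ → X →ᵇ ℝ, (∀ i x, 0 ≤ φ i x) ∧ Antitone (fun i => ⇑(φ i)) ∧
      Tendsto (fun i => ⇑(φ i)) atTop (𝓝 0) ∧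
      ∀ i, ∃ F : Set X, F.Finite ∧ ∀ x, φ i x < 1 → x ∈ Metric.thickening (r + r) F := by
  rcases isEmpty_or_nonempty X with hX | hX
  · exact ⟨0, fun i x => hX.elim x, fun i j _ x => hX.elim x, tendsto_const_nhds,
      fun i => ⟨∅, Set.finite_empty, fun x => hX.elim x⟩⟩
  obtain ⟨s, hs⟩ := TopologicalSpace.exists_dense_seq X
  let E (i : ℕ) : Set X := Metric.thickening r (s '' Set.Iic i)
  have hE : Monotone E := fun i j hij =>
    Metric.thickening_subset_of_subset r (Set.image_mono (Set.Iic_subset_Iic.mpr hij))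
  let φ (i : ℕ) : X →ᵇ ℝ := 1 - (thickenedIndicator hr (E i)).comp (fun r : ℝ≥0 => (r : ℝ))
    isometry_subtype_coe.lipschitz
  have hφ (i : ℕ) (x : X) : φ i x = 1 - (thickenedIndicator hr (E i) x : ℝ) := rfl
  refine ⟨φ, fun i x => ?_, fun i j hij x => ?_, tendsto_pi_nhds.mpr fun x => ?_,
    fun i => ⟨s '' Set.Iic i, (Set.finite_Iic i).image s, fun x hx => ?_⟩⟩
  · rw [hφ, sub_nonneg]
    exact_mod_cast thickenedIndicator_le_one hr (E i) x
  · simp only [hφ]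
    gcongr
    exact thickenedIndicator_subset hr (hE hij) x
  · obtain ⟨i, hi⟩ := hs.exists_dist_lt x hr
    refine tendsto_const_nhds.congr' ((eventually_ge_atTop i).mono fun j hij => ?_)
    have hx : x ∈ E j := Metric.mem_thickening_iff.mpr ⟨s i, ⟨i, hij, rfl⟩, hi⟩
    simp only [hφ, thickenedIndicator_one hr (E j) hx, NNReal.coe_one, sub_self, Pi.zero_apply]
  · by_contra hx'
    have hzero := thickenedIndicator_zero hr (E i) (x := x)
      (fun hmem => hx' (Metric.thickening_thickening_subset _ _ _ hmem))
    simp [hφ, hzero] at hx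

lemma isCompact_iInter_of_subset_thickening {X : Type*} [PseudoMetricSpace X] [CompleteSpace X]
    {C F : ℕ → Set X} {r : ℕ → ℝ} (hC : ∀ l, IsClosed (C l)) (hF : ∀ l, (F l).Finite)
    (hCF : ∀ l, C l ⊆ Metric.thickening (r l) (F l)) (hr : Tendsto r atTop (𝓝 0)) :
    IsCompact (⋂ l, C l) := by
  refine isCompact_iff_totallyBounded_isComplete.mpr
    ⟨Metric.totallyBounded_iff.mpr fun ε hε => ?_, (isClosed_iInter hC).isComplete⟩
  obtain ⟨l, hl⟩ := (hr.eventually_le_const hε).exists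
  refine ⟨F l, hF l, ?_⟩
  rw [← Metric.thickening_eq_biUnion_ball]
  exact (Set.iInter_subset C l).trans ((hCF l).trans (Metric.thickening_mono hl _))

lemma exists_forall_lt_of_monotone {α : Type*} [LinearOrder α] [TopologicalSpace α]
    [OrderTopology α] {a : ℕ → ℕ → α} {l : ℕ → α} {b c : α} (hmono : ∀ n, Monotone (a n))
    (ha : ∀ n, Tendsto (a n) atTop (𝓝 b)) (hal : ∀ i, Tendsto (fun n => a n i) atTop (𝓝 (l i)))
    (hl : Tendsto l atTop (𝓝 b)) (hc : c < b) : ∃ i, ∀ n, c < a n i := by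
  obtain ⟨i₀, hi₀⟩ := (hl.eventually_const_lt hc).exists
  obtain ⟨N, hN⟩ := eventually_atTop.mp ((hal i₀).eventually_const_lt hi₀)
  obtain ⟨i, hi, hi₀i⟩ := (((Set.finite_lt_nat N).eventually_all.mpr fun n _ =>
    (ha n).eventually_const_lt hc).and (eventually_ge_atTop i₀)).exists
  refine ⟨i, fun n => ?_⟩
  rcases lt_or_ge n N with hn | hn
  · exact hi n hn
  · exact (hN n hn).trans_le (hmono n hi₀i)

namespace MBase

section LaplaceTail

variable {X : Type*} [TopologicalSpace X] [MeasurableSpace X] [BorelSpace X] {h : ℕ → X →ᵇ ℝ}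

lemma monotone_laplace (h0 : ∀ k x, 0 ≤ h k x) {ψ : ℕ → testCone h}
    (hψ : Antitone fun i => ⇑(ψ i).1) (ν : MBase h) : Monotone fun i => laplace h0 (ψ i) ν :=
  fun i j hij => Real.exp_le_exp.mpr <| neg_le_neg <| integral_mono
    (integrable_of_mem_testCone h0 ν (ψ j).2) (integrable_of_mem_testCone h0 ν (ψ i).2) (hψ hij)

lemma tendsto_laplace_of_antitone (h0 : ∀ k x, 0 ≤ h k x) {ψ : ℕ → testCone h}
    (hψ : Antitone fun i => ⇑(ψ i).1) (hψ0 : Tendsto (fun i => ⇑(ψ i).1) atTop (𝓝 0))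
    (ν : MBase h) : Tendsto (fun i => laplace h0 (ψ i) ν) atTop (𝓝 1) := by
  have hint : Tendsto (fun i => ∫ x, (ψ i).1 x ∂ν.1) atTop (𝓝 (∫ _, (0 : ℝ) ∂ν.1)) := by
    refine tendsto_integral_of_dominated_convergence (ψ 0).1
      (fun i => (ψ i).1.continuous.aestronglyMeasurable)
      (integrable_of_mem_testCone h0 ν (ψ 0).2) (fun i => Eventually.of_forall fun x => ?_)
      (Eventually.of_forall fun x => tendsto_pi_nhds.mp hψ0 x)
    rw [Real.norm_of_nonneg (nonneg_of_mem_testCone h0 (ψ i).2 x)]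
    exact hψ (Nat.zero_le i) x
  have hexp := (Real.continuous_exp.tendsto _).comp hint.neg
  rwa [integral_zero, neg_zero, Real.exp_zero] at hexp

lemma tendsto_integral_laplace_of_antitone (h0 : ∀ k x, 0 ≤ h k x) {ψ : ℕ → testCone h}
    (hψ : Antitone fun i => ⇑(ψ i).1) (hψ0 : Tendsto (fun i => ⇑(ψ i).1) atTop (𝓝 0))
    (R : ProbabilityMeasure (MBase h)) :
    Tendsto (fun i => ∫ ν, laplace h0 (ψ i) ν ∂(R : Measure (MBase h))) atTop (𝓝 1) := by
  have hlim : Tendsto (fun i => ∫ ν, laplace h0 (ψ i) ν ∂(R : Measure (MBase h))) atTop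
      (𝓝 (∫ _, (1 : ℝ) ∂(R : Measure (MBase h)))) := by
    refine tendsto_integral_of_dominated_convergence (fun _ => 1)
      (fun i => (laplace h0 (ψ i)).continuous.aestronglyMeasurable) (integrable_const _)
      (fun i => Eventually.of_forall fun ν => ?_)
      (Eventually.of_forall (tendsto_laplace_of_antitone h0 hψ hψ0))
    rw [Real.norm_of_nonneg (laplace_mem_Icc h0 _ ν).1]
    exact (laplace_mem_Icc h0 _ ν).2
  simpa using hlim

lemma one_sub_exp_neg_mul_measureReal_le (h0 : ∀ k x, 0 ≤ h k x) (ψ : testCone h) {δ : ℝ}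
    (hδ : 0 ≤ δ) (R : ProbabilityMeasure (MBase h)) :
    (1 - Real.exp (-δ)) * (R : Measure (MBase h)).real {ν | δ < ∫ x, ψ.1 x ∂ν.1}
      ≤ 1 - ∫ ν, laplace h0 ψ ν ∂(R : Measure (MBase h)) := by
  have hδ' : 0 ≤ 1 - Real.exp (-δ) := sub_nonneg.mpr (Real.exp_le_one_iff.mpr (by linarith))
  calc (1 - Real.exp (-δ)) * (R : Measure (MBase h)).real {ν | δ < ∫ x, ψ.1 x ∂ν.1}
      ≤ (1 - Real.exp (-δ)) *
          (R : Measure (MBase h)).real {ν | 1 - Real.exp (-δ) ≤ 1 - laplace h0 ψ ν} :=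
        mul_le_mul_of_nonneg_left (measureReal_mono fun ν hν =>
          sub_le_sub_left (Real.exp_le_exp.mpr (neg_le_neg (Set.mem_ofPred.mp hν).le)) 1)
          hδ'
    _ ≤ ∫ ν, (1 - laplace h0 ψ ν) ∂(R : Measure (MBase h)) :=
        mul_meas_ge_le_integral_of_nonneg
          (Eventually.of_forall fun ν => sub_nonneg.mpr (laplace_mem_Icc h0 ψ ν).2)
          ((integrable_const _).sub ((laplace h0 ψ).integrable _)) _
    _ = 1 - ∫ ν, laplace h0 ψ ν ∂(R : Measure (MBase h)) := by
        rw [integral_sub (integrable_const _) ((laplace h0 ψ).integrable _), integral_const,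
          probReal_univ, one_smul]

/-- Monotone continuity at zero of a functional on test functions. A pointwise limit of Laplace
functionals of random elements of `MBase h` with this property is again a Laplace functional. -/
def ContinuousAtZero (ℓ : testCone h → ℝ) : Prop :=
  ∀ ψ : ℕ → testCone h, Antitone (fun i => ⇑(ψ i).1) →
    Tendsto (fun i => ⇑(ψ i).1) atTop (𝓝 0) → Tendsto (fun i => ℓ (ψ i)) atTop (𝓝 1)

variable {R : ℕ → ProbabilityMeasure (MBase h)} {ℓ : testCone h → ℝ}

lemma exists_forall_measure_lt_integral_le (h0 : ∀ k x, 0 ≤ h k x)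
    (hR : ∀ ψ : testCone h, Tendsto (fun n => ∫ ν, laplace h0 ψ ν ∂(R n : Measure (MBase h))) atTop
      (𝓝 (ℓ ψ))) (hℓ : ContinuousAtZero ℓ) {ψ : ℕ → testCone h}
    (hψ : Antitone fun i => ⇑(ψ i).1) (hψ0 : Tendsto (fun i => ⇑(ψ i).1) atTop (𝓝 0))
    {δ : ℝ} (hδ : 0 < δ) {ε : ℝ≥0} (hε : 0 < ε) :
    ∃ i, ∀ n, (R n : Measure (MBase h)) {ν | δ < ∫ x, (ψ i).1 x ∂ν.1} ≤ ε := by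
  have hδ' : 0 < 1 - Real.exp (-δ) := by simpa using hδ
  have hmono (n : ℕ) : Monotone fun i => ∫ ν, laplace h0 (ψ i) ν ∂(R n : Measure (MBase h)) :=
    fun i j hij => integral_mono ((laplace h0 (ψ i)).integrable _)
      ((laplace h0 (ψ j)).integrable _) fun ν => monotone_laplace h0 hψ ν hij
  obtain ⟨i, hi⟩ := exists_forall_lt_of_monotone (c := 1 - (1 - Real.exp (-δ)) * ε) hmono
    (fun n => tendsto_integral_laplace_of_antitone h0 hψ hψ0 (R n)) (fun i => hR (ψ i))
    (hℓ ψ hψ hψ0) (by simpa using mul_pos hδ' hε)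
  refine ⟨i, fun n => ?_⟩
  have hle := (one_sub_exp_neg_mul_measureReal_le h0 (ψ i) hδ.le (R n)).trans
    (sub_le_comm.mp (hi n).le)
  rw [← ENNReal.ofReal_coe_nnreal, ← ofReal_measureReal]
  exact ENNReal.ofReal_le_ofReal (le_of_mul_le_mul_left hle hδ')

lemma exists_forall_measure_lt_integral_weighted_le (h0 : ∀ k x, 0 ≤ h k x)
    (hR : ∀ ψ : testCone h, Tendsto (fun n => ∫ ν, laplace h0 ψ ν ∂(R n : Measure (MBase h))) atTop
      (𝓝 (ℓ ψ))) (hℓ : ContinuousAtZero ℓ) (k : ℕ) {φ : ℕ → X →ᵇ ℝ} (hφ : ∀ i x, 0 ≤ φ i x)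
    (hanti : Antitone fun i => ⇑(φ i)) (hlim : Tendsto (fun i => ⇑(φ i)) atTop (𝓝 0))
    {δ : ℝ} (hδ : 0 < δ) {ε : ℝ≥0} (hε : 0 < ε) :
    ∃ i, ∀ n, (R n : Measure (MBase h)) {ν | δ < ∫ x, φ i x ∂ν.weighted k} ≤ ε := by
  simp only [integral_weighted h0]
  refine exists_forall_measure_lt_integral_le h0 hR hℓ
    (ψ := fun i => ⟨φ i * h k, mul_weight_mem_testCone k (hφ i)⟩)
    (fun i j hij x => mul_le_mul_of_nonneg_right (hanti hij x) (h0 k x))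
    (tendsto_pi_nhds.mpr fun x => ?_) hδ hε
  simpa using (tendsto_pi_nhds.mp hlim x).mul_const (h k x)

lemma exists_forall_measure_lt_weighted_univ_le (h0 : ∀ k x, 0 ≤ h k x)
    (hR : ∀ ψ : testCone h, Tendsto (fun n => ∫ ν, laplace h0 ψ ν ∂(R n : Measure (MBase h))) atTop
      (𝓝 (ℓ ψ))) (hℓ : ContinuousAtZero ℓ) (k : ℕ) {ε : ℝ≥0} (hε : 0 < ε) :
    ∃ C : ℝ≥0, ∀ n, (R n : Measure (MBase h)) {ν | C < ν.weighted k Set.univ} ≤ ε := by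
  obtain ⟨i, hi⟩ := exists_forall_measure_lt_integral_weighted_le h0 hR hℓ k
    (φ := fun i => BoundedContinuousFunction.const X (1 / ((i : ℝ) + 1)))
    (fun i x => by simp only [BoundedContinuousFunction.const_apply]; positivity)
    (fun i j hij x => by simp only [BoundedContinuousFunction.const_apply]; gcongr)
    (tendsto_pi_nhds.mpr fun _ => tendsto_one_div_add_atTop_nhds_zero_nat) one_pos hε
  refine ⟨i + 1, fun n => (measure_mono fun ν hν => ?_).trans (hi n)⟩
  have hmass : (i : ℝ) + 1 < (ν.weighted k).real Set.univ :=
    ENNReal.toReal_strict_mono (measure_ne_top _ _) hν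
  simp only [BoundedContinuousFunction.const_apply, Set.mem_ofPred_eq, integral_const, smul_eq_mul]
  rwa [one_div, ← div_eq_mul_inv, one_lt_div (by positivity)]

lemma measure_weighted_compl_iInter_le (ν : MBase h) (k : ℕ) {φ : ℕ → X →ᵇ ℝ} {δ : ℕ → ℝ≥0}
    (hφ : ∀ l x, 0 ≤ φ l x) (hδ : ∀ l, ∫ x, φ l x ∂ν.weighted k ≤ δ l / 2) :
    ν.weighted k (⋂ l, {x | φ l x ≤ 1 / 2})ᶜ ≤ ∑' l, (δ l : ℝ≥0∞) := by
  rw [Set.compl_iInter]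
  refine (measure_iUnion_le _).trans (ENNReal.tsum_le_tsum fun l => ?_)
  have hmarkov := mul_meas_ge_le_integral_of_nonneg (μ := ν.weighted k)
    (Eventually.of_forall (hφ l)) ((φ l).integrable _) (1 / 2)
  have hmono : (ν.weighted k).real {x | φ l x ≤ 1 / 2}ᶜ
      ≤ (ν.weighted k).real {x | 1 / 2 ≤ φ l x} :=
    measureReal_mono fun x hx => (not_le.mp (Set.mem_ofPred.not.mp hx)).le
  rw [← ENNReal.ofReal_coe_nnreal, ← ofReal_measureReal]
  exact ENNReal.ofReal_le_ofReal (by linarith [hδ l])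

lemma exists_isCompact_forall_measure_lt_weighted_compl_le [PolishSpace X]
    (h0 : ∀ k x, 0 ≤ h k x)
    (hR : ∀ ψ : testCone h, Tendsto (fun n => ∫ ν, laplace h0 ψ ν ∂(R n : Measure (MBase h))) atTop
      (𝓝 (ℓ ψ))) (hℓ : ContinuousAtZero ℓ) (k : ℕ) {u ε : ℝ≥0} (hu : 0 < u) (hε : 0 < ε) :
    ∃ K : Set X, IsCompact K ∧
      ∀ n, (R n : Measure (MBase h)) {ν | u < ν.weighted k Kᶜ} ≤ ε := by
  let := TopologicalSpace.upgradeIsCompletelyMetrizable X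
  obtain ⟨δ, hδ, hδu⟩ := ENNReal.exists_pos_sum_of_countable (ENNReal.coe_ne_zero.mpr hu.ne') ℕ
  obtain ⟨η, hη, hηε⟩ := ENNReal.exists_pos_sum_of_countable (ENNReal.coe_ne_zero.mpr hε.ne') ℕ
  choose φ hφ hanti hlim F hF hφF using fun l : ℕ =>
    exists_antitone_tendsto_zero_mem_thickening X (Nat.one_div_pos_of_nat (α := ℝ) (n := l))
  choose I hI using fun l => exists_forall_measure_lt_integral_weighted_le h0 hR hℓ k (hφ l)
    (hanti l) (hlim l) (half_pos (NNReal.coe_pos.mpr (hδ l))) (hη l)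
  refine ⟨⋂ l, {x | φ l (I l) x ≤ 1 / 2}, ?_, fun n => ?_⟩
  · refine isCompact_iInter_of_subset_thickening
      (fun l => isClosed_le (φ l _).continuous continuous_const) (fun l => hF l (I l))
      (fun l x hx => hφF l (I l) x (lt_of_le_of_lt hx one_half_lt_one)) ?_
    simpa using (tendsto_one_div_add_atTop_nhds_zero_nat (𝕜 := ℝ)).add
      tendsto_one_div_add_atTop_nhds_zero_nat
  · calc (R n : Measure (MBase h)) {ν | u < ν.weighted k (⋂ l, {x | φ l (I l) x ≤ 1 / 2})ᶜ}
        ≤ (R n : Measure (MBase h)) (⋃ l, {ν | (δ l : ℝ) / 2 < ∫ x, φ l (I l) x ∂ν.weighted k}) :=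
          measure_mono fun ν hν => by
            by_contra hcon
            simp only [Set.mem_iUnion, Set.mem_ofPred_eq, not_exists, not_lt] at hcon
            exact hν.not_ge <|
              (measure_weighted_compl_iInter_le ν k (fun l => hφ l (I l)) hcon).trans hδu.le
      _ ≤ ∑' l, (η l : ℝ≥0∞) :=
          (measure_iUnion_le _).trans (ENNReal.tsum_le_tsum fun l => hI l n)
      _ ≤ ε := hηε.le

theorem isTightMeasureSet_of_laplace [PolishSpace X] (h0 : ∀ k x, 0 ≤ h k x)
    (hpos : ∀ x, ∃ k, 0 < h k x)
    (hR : ∀ ψ : testCone h, Tendsto (fun n => ∫ ν, laplace h0 ψ ν ∂(R n : Measure (MBase h))) atTop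
      (𝓝 (ℓ ψ))) (hℓ : ContinuousAtZero ℓ) :
    IsTightMeasureSet {((m : ProbabilityMeasure (MBase h)) : Measure (MBase h)) |
      m ∈ Set.range R} := by
  refine isTightMeasureSet_iff_exists_isCompact_measure_compl_le.mpr fun ε hε => ?_
  have hε2 : ε / 2 ≠ 0 := by simpa using hε.ne'
  obtain ⟨η, hη, hηε⟩ := ENNReal.exists_pos_sum_of_countable hε2 ℕ
  obtain ⟨θ, hθ, hθε⟩ := ENNReal.exists_pos_sum_of_countable hε2 (ℕ × ℕ)
  choose C hC using fun k => exists_forall_measure_lt_weighted_univ_le h0 hR hℓ k (hη k)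
  choose K hK hKR using fun k j => exists_isCompact_forall_measure_lt_weighted_compl_le h0 hR hℓ k
    (Nat.one_div_pos_of_nat (α := ℝ≥0) (n := j)) (hθ (k, j))
  refine ⟨_, isCompact_setOf_weighted_le h0 hpos C hK tendsto_one_div_add_atTop_nhds_zero_nat, ?_⟩
  rintro _ ⟨_, ⟨n, rfl⟩, rfl⟩
  calc (R n : Measure (MBase h)) _
      ≤ (R n : Measure (MBase h)) ((⋃ k, {ν | C k < ν.weighted k Set.univ}) ∪
          ⋃ q : ℕ × ℕ, {ν | (1 / ((q.2 : ℝ≥0) + 1) : ℝ≥0) < ν.weighted q.1 (K q.1 q.2)ᶜ}) := by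
        refine measure_mono fun ν hν => ?_
        by_contra hcon
        simp only [Set.mem_union, Set.mem_iUnion, Set.mem_ofPred_eq, not_or, not_exists, not_lt]
          at hcon
        exact hν fun k => ⟨hcon.1 k, fun j => hcon.2 (k, j)⟩
    _ ≤ ∑' k, (η k : ℝ≥0∞) + ∑' q, (θ q : ℝ≥0∞) :=
        (measure_union_le _ _).trans (add_le_add
          ((measure_iUnion_le _).trans (ENNReal.tsum_le_tsum fun k => hC k n))
          ((measure_iUnion_le _).trans (ENNReal.tsum_le_tsum fun q => hKR q.1 q.2 n)))
    _ ≤ ε / 2 + ε / 2 := add_le_add hηε.le hθε.le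
    _ = ε := ENNReal.add_halves ε

theorem exists_tendsto_of_laplace [PolishSpace X] (h0 : ∀ k x, 0 ≤ h k x)
    (hpos : ∀ x, ∃ k, 0 < h k x)
    (hR : ∀ ψ : testCone h, Tendsto (fun n => ∫ ν, laplace h0 ψ ν ∂(R n : Measure (MBase h))) atTop
      (𝓝 (ℓ ψ))) (hℓ : ContinuousAtZero ℓ) :
    ∃ R₀ : ProbabilityMeasure (MBase h), Tendsto R atTop (𝓝 R₀) := by
  have := metrizableSpace h0 hpos
  let U : Ultrafilter ℕ := Ultrafilter.of atTop
  obtain ⟨R₀, -, hR₀⟩ := (isCompact_closure_of_isTightMeasureSet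
    (isTightMeasureSet_of_laplace h0 hpos hR hℓ)).ultrafilter_le_nhds (U.map R)
    (le_principal_iff.mpr (Ultrafilter.mem_map.mpr
      (Eventually.of_forall fun n => subset_closure ⟨n, rfl⟩)))
  refine ⟨R₀, tendsto_of_laplace h0 fun ψ => ?_⟩
  have hU : Tendsto (fun n => ∫ ν, laplace h0 ψ ν ∂(R n : Measure (MBase h))) U
      (𝓝 (∫ ν, laplace h0 ψ ν ∂(R₀ : Measure (MBase h)))) :=
    ProbabilityMeasure.tendsto_iff_forall_integral_tendsto.mp hR₀ (laplace h0 ψ)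
  rw [tendsto_nhds_unique hU ((hR ψ).mono_left (Ultrafilter.of_le atTop))]
  exact hR ψ

end LaplaceTail

end MBase

/-- The function `x ↦ exp (-x)` on `[0, ∞]`. -/
def expNeg (x : ℝ≥0∞) : ℝ≥0∞ := EReal.exp (-(x : EReal))

@[simp] lemma expNeg_zero : expNeg 0 = 1 := by simp [expNeg]

@[simp] lemma expNeg_top : expNeg ∞ = 0 := by simp [expNeg]

lemma expNeg_ofReal {r : ℝ} (hr : 0 ≤ r) :
    expNeg (ENNReal.ofReal r) = ENNReal.ofReal (Real.exp (-r)) := by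
  rw [expNeg, EReal.coe_ennreal_ofReal, max_eq_left hr, ← EReal.coe_neg, EReal.exp_coe]

lemma expNeg_add (x y : ℝ≥0∞) : expNeg (x + y) = expNeg x * expNeg y := by
  rw [expNeg, EReal.coe_ennreal_add, EReal.neg_add (by simp) (by simp), sub_eq_add_neg,
    EReal.exp_add]
  rfl

lemma strictAnti_expNeg : StrictAnti expNeg := fun _ _ hxy =>
  EReal.exp_strictMono (EReal.neg_lt_neg_iff.mpr (EReal.coe_ennreal_lt_coe_ennreal_iff.mpr hxy))

lemma continuous_expNeg : Continuous expNeg :=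
  ENNReal.continuous_exp.comp (continuous_neg.comp continuous_coe_ennreal_ereal)

@[fun_prop] lemma measurable_expNeg : Measurable expNeg := continuous_expNeg.measurable

lemma expNeg_le_one (x : ℝ≥0∞) : expNeg x ≤ 1 :=
  expNeg_zero ▸ strictAnti_expNeg.antitone (zero_le (a := x))

lemma expNeg_ne_top (x : ℝ≥0∞) : expNeg x ≠ ∞ :=
  ne_top_of_le_ne_top ENNReal.one_ne_top (expNeg_le_one x)

lemma expNeg_sum {ι : Type*} (s : Finset ι) (f : ι → ℝ≥0∞) :
    expNeg (∑ i ∈ s, f i) = ∏ i ∈ s, expNeg (f i) := by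
  classical
  induction s using Finset.induction_on with
  | empty => simp
  | insert i s hi ih => rw [Finset.sum_insert hi, Finset.prod_insert hi, expNeg_add, ih]

lemma expNeg_mul_natCast (a : ℝ≥0∞) (n : ℕ) : expNeg (a * n) = expNeg a ^ n := by
  induction n with
  | zero => simp
  | succ n ih => rw [Nat.cast_succ, mul_add, mul_one, expNeg_add, ih, pow_succ]

lemma lintegral_pow_poissonMeasure (r : ℝ≥0) {c : ℝ≥0∞} (hc : c ≤ 1) :
    ∫⁻ n, c ^ n ∂poissonMeasure r = expNeg ((1 - c) * r) := by
  lift c to ℝ≥0 using ne_top_of_le_ne_top ENNReal.one_ne_top hc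
  have hc' : c ≤ 1 := by exact_mod_cast hc
  have hsum : HasSum (fun n : ℕ => Real.exp (-r) * ((r * c : ℝ) ^ n / n.factorial))
      (Real.exp (-r) * Real.exp (r * c)) := by
    rw [Real.exp_eq_exp_ℝ]
    exact (NormedSpace.expSeries_div_hasSum_exp (r * c : ℝ)).mul_left _
  calc ∫⁻ n, (c : ℝ≥0∞) ^ n ∂poissonMeasure r
      = ∑' n : ℕ, ENNReal.ofReal (Real.exp (-r) * ((r * c : ℝ) ^ n / n.factorial)) := by
        rw [poissonMeasure, lintegral_sum_measure]
        refine tsum_congr fun n => ?_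
        rw [lintegral_smul_measure, lintegral_dirac, smul_eq_mul, ← ENNReal.coe_pow,
          ← ENNReal.ofReal_coe_nnreal, ← ENNReal.ofReal_mul (by positivity)]
        congr 1
        push_cast
        ring
    _ = ENNReal.ofReal (Real.exp (-((1 - c) * r))) := by
        rw [← ENNReal.ofReal_tsum_of_nonneg (fun n => by positivity) hsum.summable, hsum.tsum_eq,
          ← Real.exp_add]
        ring_nf
    _ = expNeg ((1 - c) * r) := by
        rw [← expNeg_ofReal (mul_nonneg (sub_nonneg.mpr (by exact_mod_cast hc')) r.coe_nonneg),
          ENNReal.ofReal_mul (by simpa using hc'), ENNReal.ofReal_sub _ c.coe_nonneg,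
          ENNReal.ofReal_one, ENNReal.ofReal_coe_nnreal, ENNReal.ofReal_coe_nnreal]

lemma lintegral_expNeg_poissonMeasure (a : ℝ≥0∞) (r : ℝ≥0) :
    ∫⁻ y, expNeg (a * y) ∂(poissonMeasure r).map (fun n : ℕ => (n : ℝ≥0∞))
      = expNeg ((1 - expNeg a) * r) := by
  rw [lintegral_map (by fun_prop) .of_discrete]
  simp only [expNeg_mul_natCast]
  exact lintegral_pow_poissonMeasure r (expNeg_le_one a)

lemma exists_finMeasSupp_monotone_tendsto {X : Type*} [MeasurableSpace X] (ν : Measure X)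
    [SigmaFinite ν] {f : X → ℝ≥0∞} (hf : Measurable f) :
    ∃ s : ℕ → SimpleFunc X ℝ≥0∞, (∀ n, (s n).FinMeasSupp ν) ∧
      (∀ x, Monotone fun n => s n x) ∧ ∀ x, Tendsto (fun n => s n x) atTop (𝓝 (f x)) := by
  let s (n : ℕ) : SimpleFunc X ℝ≥0∞ := (SimpleFunc.eapprox f n).restrict (spanningSets ν n)
  have hs (n : ℕ) (x : X) : s n x = (spanningSets ν n).indicator (SimpleFunc.eapprox f n) x :=
    SimpleFunc.restrict_apply _ (measurableSet_spanningSets ν n) x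
  refine ⟨s, fun n => SimpleFunc.finMeasSupp_iff.mpr fun r hr => ?_, fun x i j hij => ?_,
    fun x => ?_⟩
  · refine (measure_mono fun x hx => ?_).trans_lt (measure_spanningSets_lt_top ν n)
    by_contra hx'
    rw [Set.mem_preimage, Set.mem_singleton_iff, hs, Set.indicator_of_notMem hx'] at hx
    exact hr hx.symm
  · simp only [hs]
    exact (Set.indicator_le_indicator_of_subset (monotone_spanningSets ν hij)
      (fun _ => zero_le) x).trans
      (Set.indicator_le_indicator (SimpleFunc.monotone_eapprox f hij x))
  · have happrox : Tendsto (fun n => SimpleFunc.eapprox f n x) atTop (𝓝 (f x)) := by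
      rw [← SimpleFunc.iSup_eapprox_apply hf x]
      exact tendsto_atTop_iSup fun i j hij => SimpleFunc.monotone_eapprox f hij x
    refine happrox.congr' ?_
    filter_upwards [eventually_ge_atTop (spanningSetsIndex ν x)] with n hn
    rw [hs, Set.indicator_of_mem (monotone_spanningSets ν hn (mem_spanningSetsIndex ν x))]

namespace IsPoissonRandomMeasure

section LaplaceFunctional

variable {Ω X : Type*} [MeasurableSpace Ω] [MeasurableSpace X] {P : Measure Ω}
  {N : Ω → Measure X} {ν : Measure X}

lemma iIndepFun_of_countable {ι : Type*} [Countable ι] (hN : IsPoissonRandomMeasure P N ν)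
    {A : ι → Set X} (hA : ∀ i, MeasurableSet (A i)) (hAd : Pairwise (Function.onFun Disjoint A)) :
    iIndepFun (fun i ω => N ω (A i)) P := by
  have := Encodable.ofCountable ι
  have hind := (hN.indep (fun n => ⋃ i ∈ Encodable.decode₂ ι n, A i)
    (fun n => .iUnion fun i => .iUnion fun _ => hA i)
    (Encodable.iUnion_decode₂_disjoint_on hAd)).precomp (Encodable.encode_injective (α := ι))
  simpa [Encodable.decode₂_encode] using hind

lemma lintegral_expNeg_mul (hN : IsPoissonRandomMeasure P N ν) (hmeas : Measurable N) {A : Set X}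
    (hA : MeasurableSet A) (hfin : ν A < ∞) (a : ℝ≥0∞) :
    ∫⁻ ω, expNeg (a * N ω A) ∂P = expNeg ((1 - expNeg a) * ν A) := by
  have hNA : Measurable fun ω => N ω A := (Measure.measurable_coe hA).comp hmeas
  rw [← lintegral_map (f := fun y => expNeg (a * y)) (by fun_prop) hNA, hN.poisson A hA hfin,
    lintegral_expNeg_poissonMeasure, ENNReal.coe_toNNReal hfin.ne]

variable [IsProbabilityMeasure P]

lemma lintegral_expNeg_simpleFunc (hN : IsPoissonRandomMeasure P N ν) (hmeas : Measurable N)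
    {s : SimpleFunc X ℝ≥0∞} (hs : s.FinMeasSupp ν) :
    ∫⁻ ω, expNeg (∫⁻ x, s x ∂N ω) ∂P = expNeg (∫⁻ x, (1 - expNeg (s x)) ∂ν) := by
  have hind : iIndepFun (fun (r : s.range) ω => expNeg (r * N ω (s ⁻¹' {(r : ℝ≥0∞)}))) P :=
    (hN.iIndepFun_of_countable (fun r : s.range => s.measurableSet_fiber r)
      fun r r' hrr' => (Set.disjoint_singleton.mpr (Subtype.coe_ne_coe.mpr hrr')).preimage s).comp
      (fun r y => expNeg (r * y)) fun r => by fun_prop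
  calc ∫⁻ ω, expNeg (∫⁻ x, s x ∂N ω) ∂P
      = ∫⁻ ω, ∏ r : s.range, expNeg (r * N ω (s ⁻¹' {(r : ℝ≥0∞)})) ∂P := by
        simp only [SimpleFunc.lintegral_eq_lintegral, SimpleFunc.lintegral, expNeg_sum]
        simp only [← Finset.prod_coe_sort s.range]
    _ = ∏ r : s.range, ∫⁻ ω, expNeg (r * N ω (s ⁻¹' {(r : ℝ≥0∞)})) ∂P :=
        lintegral_prod_eq_prod_lintegral_of_indepFun _ _ hind fun r =>
          measurable_expNeg.comp
            (((Measure.measurable_coe (s.measurableSet_fiber r)).comp hmeas).const_mul _)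
    _ = ∏ r : s.range, expNeg ((1 - expNeg r) * ν (s ⁻¹' {(r : ℝ≥0∞)})) := by
        refine Finset.prod_congr rfl fun r _ => ?_
        rcases eq_or_ne (r : ℝ≥0∞) 0 with hr | hr
        · simp [hr]
        · exact hN.lintegral_expNeg_mul hmeas (s.measurableSet_fiber r)
            (SimpleFunc.finMeasSupp_iff.mp hs r hr) r
    _ = expNeg (∫⁻ x, s.map (fun r => 1 - expNeg r) x ∂ν) := by
        rw [SimpleFunc.lintegral_eq_lintegral, SimpleFunc.map_lintegral, expNeg_sum,
          ← Finset.prod_coe_sort s.range]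

theorem lintegral_expNeg [SigmaFinite ν] (hN : IsPoissonRandomMeasure P N ν)
    (hmeas : Measurable N) {f : X → ℝ≥0∞} (hf : Measurable f) :
    ∫⁻ ω, expNeg (∫⁻ x, f x ∂N ω) ∂P = expNeg (∫⁻ x, (1 - expNeg (f x)) ∂ν) := by
  obtain ⟨s, hs, hmono, hlim⟩ := exists_finMeasSupp_monotone_tendsto ν hf
  have hleft : Tendsto (fun n => ∫⁻ ω, expNeg (∫⁻ x, s n x ∂N ω) ∂P) atTop
      (𝓝 (∫⁻ ω, expNeg (∫⁻ x, f x ∂N ω) ∂P)) := by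
    refine tendsto_lintegral_of_dominated_convergence (fun _ => 1)
      (fun n => measurable_expNeg.comp
        ((Measure.measurable_lintegral (s n).measurable).comp hmeas))
      (fun n => Eventually.of_forall fun ω => expNeg_le_one _) (by simp)
      (Eventually.of_forall fun ω => (continuous_expNeg.tendsto _).comp ?_)
    exact lintegral_tendsto_of_tendsto_of_monotone (fun n => (s n).measurable.aemeasurable)
      (Eventually.of_forall hmono) (Eventually.of_forall hlim)
  have hright : Tendsto (fun n => expNeg (∫⁻ x, (1 - expNeg (s n x)) ∂ν)) atTop
      (𝓝 (expNeg (∫⁻ x, (1 - expNeg (f x)) ∂ν))) := by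
    refine (continuous_expNeg.tendsto _).comp (lintegral_tendsto_of_tendsto_of_monotone
      (fun n => (Measurable.const_sub (measurable_expNeg.comp (s n).measurable) 1).aemeasurable)
      (Eventually.of_forall fun x i j hij =>
        tsub_le_tsub_left (strictAnti_expNeg.antitone (hmono x hij)) 1)
      (Eventually.of_forall fun x => ?_))
    exact ENNReal.Tendsto.sub tendsto_const_nhds ((continuous_expNeg.tendsto _).comp (hlim x))
      (Or.inl ENNReal.one_ne_top)
  exact tendsto_nhds_unique hleft
    (hright.congr fun n => (hN.lintegral_expNeg_simpleFunc hmeas (hs n)).symm)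

end LaplaceFunctional

end IsPoissonRandomMeasure

section ExpNegSum

variable {ι : Type*} [Fintype ι]

lemma isInducing_toReal_expNeg : IsInducing fun x : ℝ≥0∞ => (expNeg x).toReal := by
  have hcont : Continuous fun x : ℝ≥0∞ => (expNeg x).toReal :=
    ENNReal.continuousOn_toReal.comp_continuous continuous_expNeg expNeg_ne_top
  refine (hcont.isClosedEmbedding fun x y hxy => strictAnti_expNeg.injective ?_).isInducing
  exact (ENNReal.toReal_eq_toReal_iff' (expNeg_ne_top x) (expNeg_ne_top y)).mp hxy

/-- The bounded continuous function `y ↦ exp (-∑ i, a i * y i)` on `[0, ∞] ^ ι`. -/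
def expNegSum (a : ι → ℕ) : (ι → ℝ≥0∞) →ᵇ ℝ :=
  BoundedContinuousFunction.mkOfCompact ⟨fun y => ∏ i, (expNeg (y i)).toReal ^ a i, by
    refine continuous_finsetProd _ fun i _ => Continuous.pow ?_ _
    exact isInducing_toReal_expNeg.continuous.comp (continuous_apply i)⟩

lemma expNegSum_apply (a : ι → ℕ) (y : ι → ℝ≥0∞) :
    expNegSum a y = (expNeg (∑ i, (a i : ℝ≥0∞) * y i)).toReal := by
  rw [expNeg_sum, ENNReal.toReal_prod]
  refine Finset.prod_congr rfl fun i _ => ?_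
  rw [mul_comm, expNeg_mul_natCast, ENNReal.toReal_pow]

/-- The multiplicative family of all functions `expNegSum a`. -/
def expNegSumMonoid (ι : Type*) [Fintype ι] : Submonoid ((ι → ℝ≥0∞) →ᵇ ℝ) where
  carrier := Set.range expNegSum
  one_mem' := ⟨0, by ext y; simp [expNegSum]⟩
  mul_mem' := by
    rintro _ _ ⟨a, rfl⟩ ⟨b, rfl⟩
    exact ⟨a + b, by ext y; simp [expNegSum, pow_add, Finset.prod_mul_distrib]⟩

lemma expNegSum_single [DecidableEq ι] (i : ι) (y : ι → ℝ≥0∞) :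
    expNegSum (Pi.single i 1) y = (expNeg (y i)).toReal := by
  rw [expNegSum_apply]
  simp [Pi.single_apply]

lemma integral_expNegSum (a : ι → ℕ) (P : Measure (ι → ℝ≥0∞)) :
    ∫ y, expNegSum a y ∂P = (∫⁻ y, expNeg (∑ i, (a i : ℝ≥0∞) * y i) ∂P).toReal := by
  simp only [expNegSum_apply]
  exact integral_toReal (Measurable.aemeasurable (by fun_prop))
    (Eventually.of_forall fun y => (expNeg_ne_top _).lt_top)

theorem eq_of_lintegral_expNeg_sum {P P' : Measure (ι → ℝ≥0∞)} [IsProbabilityMeasure P]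
    [IsProbabilityMeasure P']
    (hPP' : ∀ a : ι → ℕ, ∫⁻ y, expNeg (∑ i, (a i : ℝ≥0∞) * y i) ∂P
      = ∫⁻ y, expNeg (∑ i, (a i : ℝ≥0∞) * y i) ∂P') : P = P' := by
  classical
  have hind : IsInducing fun (y : ι → ℝ≥0∞) i => expNegSum (Pi.single i 1) y := by
    simp only [expNegSum_single]
    exact IsInducing.piMap (f := fun (_ : ι) (x : ℝ≥0∞) => (expNeg x).toReal)
      fun _ => isInducing_toReal_expNeg
  let p : ProbabilityMeasure (ι → ℝ≥0∞) := ⟨P, inferInstance⟩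
  let p' : ProbabilityMeasure (ι → ℝ≥0∞) := ⟨P', inferInstance⟩
  refine congrArg ProbabilityMeasure.toMeasure (tendsto_const_nhds_iff (l := (atTop : Filter ℕ))
    (c := p) (d := p') |>.mp (tendsto_of_isInducing_of_submonoid (expNegSumMonoid ι)
      (fun i => expNegSum (Pi.single i 1)) (fun i => ⟨_, rfl⟩) (fun i y => ?_) hind ?_))
  · rw [expNegSum_single]
    exact ⟨ENNReal.toReal_nonneg, ENNReal.toReal_mono ENNReal.one_ne_top (expNeg_le_one _)⟩
  · rintro _ ⟨a, rfl⟩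
    simp only [p, p', ProbabilityMeasure.coe_mk, integral_expNegSum, hPP' a]
    exact tendsto_const_nhds

lemma eq_of_lintegral_expNeg_mul {P P' : Measure ℝ≥0∞} [IsProbabilityMeasure P]
    [IsProbabilityMeasure P']
    (hPP' : ∀ a : ℕ, ∫⁻ y, expNeg (a * y) ∂P = ∫⁻ y, expNeg (a * y) ∂P') : P = P' := by
  let e := (MeasurableEquiv.funUnique Unit ℝ≥0∞).symm
  have := Measure.isProbabilityMeasure_map (μ := P) e.measurable.aemeasurable
  have := Measure.isProbabilityMeasure_map (μ := P') e.measurable.aemeasurable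
  refine e.map_measurableEquiv_injective (eq_of_lintegral_expNeg_sum fun a => ?_)
  rw [lintegral_map_equiv, lintegral_map_equiv]
  simpa [e] using hPP' (a ())

theorem iIndepFun_of_lintegral_expNeg_sum {Ω : Type*} [MeasurableSpace Ω] {P : Measure Ω}
    [IsProbabilityMeasure P] {Y : ι → Ω → ℝ≥0∞} (hY : ∀ i, Measurable (Y i))
    (hprod : ∀ a : ι → ℕ, ∫⁻ ω, expNeg (∑ i, (a i : ℝ≥0∞) * Y i ω) ∂P
      = ∏ i, ∫⁻ ω, expNeg ((a i : ℝ≥0∞) * Y i ω) ∂P) : iIndepFun Y P := by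
  rw [iIndepFun_iff_map_fun_eq_pi_map fun i => (hY i).aemeasurable]
  have (i : ι) := Measure.isProbabilityMeasure_map (μ := P) (hY i).aemeasurable
  have := Measure.isProbabilityMeasure_map (μ := P) (measurable_pi_lambda _ hY).aemeasurable
  refine eq_of_lintegral_expNeg_sum fun a => ?_
  have hpi : iIndepFun (fun i (y : ι → ℝ≥0∞) => expNeg ((a i : ℝ≥0∞) * y i))
      (Measure.pi fun i => P.map (Y i)) :=
    iIndepFun_pi (X := fun i (y : ℝ≥0∞) => expNeg ((a i : ℝ≥0∞) * y)) fun i => by fun_prop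
  rw [lintegral_map (by fun_prop) (measurable_pi_lambda _ hY), hprod]
  simp only [expNeg_sum]
  rw [lintegral_prod_eq_prod_lintegral_of_indepFun _ _ hpi fun i => by fun_prop]
  refine Finset.prod_congr rfl fun i _ => ?_
  have heval := (measurePreserving_eval (fun i => P.map (Y i)) i).lintegral_comp
    (f := fun y => expNeg ((a i : ℝ≥0∞) * y)) (by fun_prop)
  exact (lintegral_map (by fun_prop) (hY i)).symm.trans heval.symm

end ExpNegSum

namespace IsPoissonRandomMeasure

section OfLaplace

variable {Ω X : Type*} [MeasurableSpace Ω] [MeasurableSpace X] {P : Measure Ω}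
  {N : Ω → Measure X} {ν : Measure X}

lemma lintegral_expNeg_sum_of_laplace
    (hL : ∀ f : X → ℝ≥0∞, Measurable f →
      ∫⁻ ω, expNeg (∫⁻ x, f x ∂N ω) ∂P = expNeg (∫⁻ x, (1 - expNeg (f x)) ∂ν))
    {ι : Type*} [Fintype ι] {A : ι → Set X} (hA : ∀ i, MeasurableSet (A i))
    (hd : Pairwise (Function.onFun Disjoint A)) (a : ι → ℕ) :
    ∫⁻ ω, expNeg (∑ i, (a i : ℝ≥0∞) * N ω (A i)) ∂P
      = ∏ i, expNeg ((1 - expNeg (a i)) * ν (A i)) := by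
  have hint (c : ι → ℝ≥0∞) (μ : Measure X) :
      ∫⁻ x, ∑ i, (A i).indicator (fun _ => c i) x ∂μ = ∑ i, c i * μ (A i) := by
    rw [lintegral_finsetSum _ fun i _ => measurable_const.indicator (hA i)]
    exact Finset.sum_congr rfl fun i _ => lintegral_indicator_const (hA i) _
  have hsum (x : X) : 1 - expNeg (∑ i, (A i).indicator (fun _ => (a i : ℝ≥0∞)) x)
      = ∑ i, (A i).indicator (fun _ => 1 - expNeg (a i)) x := by
    by_cases hx : ∃ i, x ∈ A i
    · obtain ⟨i, hi⟩ := hx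
      have hne (j : ι) (hj : j ≠ i) : x ∉ A j :=
        fun hxj => Set.disjoint_left.mp (hd hj) hxj hi
      rw [Finset.sum_eq_single i (fun j _ hj => Set.indicator_of_notMem (hne j hj) _) (by simp),
        Finset.sum_eq_single i (fun j _ hj => Set.indicator_of_notMem (hne j hj) _) (by simp),
        Set.indicator_of_mem hi, Set.indicator_of_mem hi]
    · push Not at hx
      simp [hx]
  have hlaplace := hL (fun x => ∑ i, (A i).indicator (fun _ => (a i : ℝ≥0∞)) x)
    (Finset.measurable_sum _ fun i _ => measurable_const.indicator (hA i))
  simp only [hsum] at hlaplace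
  simpa only [hint, expNeg_sum] using hlaplace

lemma lintegral_expNeg_mul_of_laplace
    (hL : ∀ f : X → ℝ≥0∞, Measurable f →
      ∫⁻ ω, expNeg (∫⁻ x, f x ∂N ω) ∂P = expNeg (∫⁻ x, (1 - expNeg (f x)) ∂ν))
    {A : Set X} (hA : MeasurableSet A) (a : ℕ) :
    ∫⁻ ω, expNeg (a * N ω A) ∂P = expNeg ((1 - expNeg a) * ν A) := by
  simpa using lintegral_expNeg_sum_of_laplace hL (ι := Unit) (fun _ => hA)
    Subsingleton.pairwise (fun _ => a)

theorem of_laplace [IsProbabilityMeasure P] (hmeas : Measurable N)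
    (hcount : ∀ᵐ ω ∂P, ∀ A, MeasurableSet A → ∃ n : ℕ∞, N ω A = (n : ℝ≥0∞))
    (hL : ∀ f : X → ℝ≥0∞, Measurable f →
      ∫⁻ ω, expNeg (∫⁻ x, f x ∂N ω) ∂P = expNeg (∫⁻ x, (1 - expNeg (f x)) ∂ν)) :
    IsPoissonRandomMeasure P N ν where
  counting := hcount
  poisson A hA hfin := by
    have hNA : Measurable fun ω => N ω A := (Measure.measurable_coe hA).comp hmeas
    have := Measure.isProbabilityMeasure_map (μ := P) hNA.aemeasurable
    refine eq_of_lintegral_expNeg_mul fun a => ?_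
    rw [lintegral_map (by fun_prop) hNA, lintegral_expNeg_mul_of_laplace hL hA,
      lintegral_expNeg_poissonMeasure, ENNReal.coe_toNNReal hfin.ne]
  indep A hA hd := by
    refine iIndepFun_iff_finset.mpr fun s => iIndepFun_of_lintegral_expNeg_sum
      (fun i => (Measure.measurable_coe (hA i)).comp hmeas) fun a => ?_
    refine (lintegral_expNeg_sum_of_laplace hL (fun i : s => hA i)
      (hd.comp_of_injective Subtype.val_injective) a).trans ?_
    exact Finset.prod_congr rfl fun i _ =>
      (lintegral_expNeg_mul_of_laplace hL (hA i) (a i)).symm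

end OfLaplace

end IsPoissonRandomMeasure

section Construction

lemma lintegral_expNeg_tsum_of_iIndepFun {Ω : Type*} [MeasurableSpace Ω] {P : Measure Ω}
    [IsProbabilityMeasure P] {Y : ℕ → Ω → ℝ≥0∞} (hY : ∀ i, Measurable (Y i)) (hind : iIndepFun Y P)
    {c : ℕ → ℝ≥0∞} (hc : ∀ i, ∫⁻ ω, expNeg (Y i ω) ∂P = expNeg (c i)) :
    ∫⁻ ω, expNeg (∑' i, Y i ω) ∂P = expNeg (∑' i, c i) := by
  have hfinite (n : ℕ) : ∫⁻ ω, expNeg (∑ i ∈ Finset.range n, Y i ω) ∂P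
      = expNeg (∑ i ∈ Finset.range n, c i) := by
    simp only [expNeg_sum, ← hc]
    exact lintegral_prod_eq_prod_lintegral_of_indepFun _ _
      (hind.comp (fun _ => expNeg) fun _ => measurable_expNeg)
      fun i => measurable_expNeg.comp (hY i)
  have hleft : Tendsto (fun n => ∫⁻ ω, expNeg (∑ i ∈ Finset.range n, Y i ω) ∂P) atTop
      (𝓝 (∫⁻ ω, expNeg (∑' i, Y i ω) ∂P)) :=
    tendsto_lintegral_of_dominated_convergence (fun _ => 1)
      (fun n => measurable_expNeg.comp (Finset.measurable_sum _ fun i _ => hY i))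
      (fun n => Eventually.of_forall fun ω => expNeg_le_one _) (by simp)
      (Eventually.of_forall fun ω =>
        (continuous_expNeg.tendsto _).comp (ENNReal.tendsto_nat_tsum _))
  have hright := (continuous_expNeg.tendsto _).comp (ENNReal.tendsto_nat_tsum c)
  exact tendsto_nhds_unique hleft (hright.congr fun n => (hfinite n).symm)

variable {X : Type*} [MeasurableSpace X]

/-- The sum of the point masses at the first `q.1` points of the sequence `q.2`. -/
def pointSum (q : ℕ × (ℕ → X)) : Measure X := ∑ j ∈ Finset.range q.1, Measure.dirac (q.2 j)

lemma lintegral_pointSum (q : ℕ × (ℕ → X)) {f : X → ℝ≥0∞} (hf : Measurable f) :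
    ∫⁻ x, f x ∂pointSum q = ∑ j ∈ Finset.range q.1, f (q.2 j) := by
  rw [pointSum, lintegral_finsetSum_measure]
  exact Finset.sum_congr rfl fun j _ => lintegral_dirac' _ hf

lemma measurable_lintegral_pointSum {f : X → ℝ≥0∞} (hf : Measurable f) :
    Measurable fun q : ℕ × (ℕ → X) => ∫⁻ x, f x ∂pointSum q := by
  simp only [lintegral_pointSum _ hf]
  refine measurable_from_prod_countable_right fun n => ?_
  change Measurable fun z : ℕ → X => ∑ j ∈ Finset.range n, f (z j)
  exact Finset.measurable_sum _ fun j _ => hf.comp (measurable_pi_apply j)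

/-- The law of a Poisson number, with parameter `r`, together with a sequence of independent points
with law `p`. -/
def poissonPoints (r : ℝ≥0) (p : Measure X) : Measure (ℕ × (ℕ → X)) :=
  (poissonMeasure r).prod (Measure.infinitePi fun _ : ℕ => p)

instance (r : ℝ≥0) (p : Measure X) [IsProbabilityMeasure p] :
    IsProbabilityMeasure (poissonPoints r p) := by
  unfold poissonPoints; infer_instance

lemma lintegral_expNeg_sum_range_infinitePi (p : Measure X) [IsProbabilityMeasure p]
    {f : X → ℝ≥0∞} (hf : Measurable f) (n : ℕ) :
    ∫⁻ z, expNeg (∑ j ∈ Finset.range n, f (z j)) ∂Measure.infinitePi (fun _ : ℕ => p)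
      = (∫⁻ x, expNeg (f x) ∂p) ^ n := by
  have hmf : Measurable fun x => expNeg (f x) := measurable_expNeg.comp hf
  have hind : iIndepFun (fun (j : ℕ) (z : ℕ → X) => expNeg (f (z j)))
      (Measure.infinitePi fun _ : ℕ => p) :=
    iIndepFun_infinitePi (X := fun (_ : ℕ) x => expNeg (f x)) fun _ => hmf
  have heval (j : ℕ) : ∫⁻ z, expNeg (f (z j)) ∂Measure.infinitePi (fun _ : ℕ => p)
      = ∫⁻ x, expNeg (f x) ∂p := by
    conv_rhs => rw [← Measure.infinitePi_map_eval (fun _ : ℕ => p) j]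
    rw [lintegral_map hmf (measurable_pi_apply j)]
  simp only [expNeg_sum]
  rw [lintegral_prod_eq_prod_lintegral_of_indepFun _ _ hind
    fun j => hmf.comp (measurable_pi_apply j)]
  simp [heval]

lemma lintegral_expNeg_pointSum (r : ℝ≥0) (p : Measure X) [IsProbabilityMeasure p]
    {f : X → ℝ≥0∞} (hf : Measurable f) :
    ∫⁻ q, expNeg (∫⁻ x, f x ∂pointSum q) ∂poissonPoints r p
      = expNeg (r * ∫⁻ x, (1 - expNeg (f x)) ∂p) := by
  have hle : ∫⁻ x, expNeg (f x) ∂p ≤ 1 :=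
    (lintegral_mono fun x => expNeg_le_one (f x)).trans (by simp)
  have hmf : Measurable fun x => expNeg (f x) := measurable_expNeg.comp hf
  have hmeas : Measurable fun q : ℕ × (ℕ → X) => expNeg (∫⁻ x, f x ∂pointSum q) :=
    measurable_expNeg.comp (measurable_lintegral_pointSum hf)
  rw [poissonPoints, lintegral_prod _ hmeas.aemeasurable]
  simp only [lintegral_pointSum _ hf, lintegral_expNeg_sum_range_infinitePi p hf]
  rw [lintegral_pow_poissonMeasure r hle, mul_comm, lintegral_sub hmf
    (ne_top_of_le_ne_top ENNReal.one_ne_top hle) (Eventually.of_forall fun x => expNeg_le_one _)]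
  simp

/-- The superposition of a sequence of finite point configurations. -/
def superposition (ω : ℕ → ℕ × (ℕ → X)) : Measure X := Measure.sum fun i => pointSum (ω i)

lemma lintegral_superposition (ω : ℕ → ℕ × (ℕ → X)) (f : X → ℝ≥0∞) :
    ∫⁻ x, f x ∂superposition ω = ∑' i, ∫⁻ x, f x ∂pointSum (ω i) :=
  lintegral_sum_measure _ _

lemma measurable_superposition : Measurable (superposition (X := X)) := by
  refine Measure.measurable_of_measurable_coe _ fun A hA => ?_
  simp only [← lintegral_indicator_one hA, lintegral_superposition]
  refine Measurable.tsum fun i => ?_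
  exact (measurable_lintegral_pointSum (measurable_one.indicator hA)).comp (measurable_pi_apply i)

lemma exists_superposition_apply_eq_toENNReal (ω : ℕ → ℕ × (ℕ → X)) {A : Set X}
    (hA : MeasurableSet A) : ∃ n : ℕ∞, superposition ω A = (n : ℝ≥0∞) := by
  let T : Set ((i : ℕ) × Fin (ω i).1) := {q | (ω q.1).2 q.2 ∈ A}
  have htsum : superposition ω A = ∑' q, T.indicator (fun _ => (1 : ℝ≥0∞)) q := by
    rw [← lintegral_indicator_one hA, lintegral_superposition, ENNReal.tsum_sigma']
    refine tsum_congr fun i => ?_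
    rw [lintegral_pointSum _ (measurable_one.indicator hA), Finset.sum_range, tsum_fintype]
    rfl
  exact ⟨ENat.card T, by rw [htsum, ← tsum_subtype, ENNReal.tsum_one]⟩

lemma lintegral_expNeg_superposition [Nonempty X] (m : ℕ → FiniteMeasure X) {f : X → ℝ≥0∞}
    (hf : Measurable f) :
    ∫⁻ ω, expNeg (∫⁻ x, f x ∂superposition ω)
        ∂(Measure.infinitePi fun i => poissonPoints (m i).mass ((m i).normalize : Measure X))
      = expNeg (∑' i, ∫⁻ x, (1 - expNeg (f x)) ∂(m i : Measure X)) := by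
  have hmeas := measurable_lintegral_pointSum hf
  simp only [lintegral_superposition]
  refine lintegral_expNeg_tsum_of_iIndepFun (fun i => hmeas.comp (measurable_pi_apply i))
    (iIndepFun_infinitePi (X := fun (_ : ℕ) q => ∫⁻ x, f x ∂pointSum q) fun _ => hmeas)
    fun i => ?_
  have hsmul : (m i : Measure X) = ((m i).mass : ℝ≥0∞) • ((m i).normalize : Measure X) := by
    conv_lhs => rw [(m i).self_eq_mass_smul_normalize]
    rfl
  rw [hsmul, lintegral_smul_measure, smul_eq_mul, ← lintegral_expNeg_pointSum _ _ hf]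
  exact (measurePreserving_eval_infinitePi
    (fun i => poissonPoints (m i).mass ((m i).normalize : Measure X)) i).lintegral_comp
    (measurable_expNeg.comp hmeas)

universe u

theorem exists_isPoissonRandomMeasure {X : Type u} [MeasurableSpace X] (ν : Measure X)
    [SFinite ν] :
    ∃ (Ω : Type u) (_ : MeasurableSpace Ω) (P : Measure Ω) (N : Ω → Measure X),
      IsProbabilityMeasure P ∧ Measurable N ∧ IsPoissonRandomMeasure P N ν := by
  rcases isEmpty_or_nonempty X with hX | hX
  · refine ⟨PUnit, inferInstance, Measure.dirac PUnit.unit, 0, inferInstance, measurable_const, ?_⟩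
    refine .of_laplace measurable_const (Eventually.of_forall fun ω A _ => ⟨0, by simp⟩)
      fun f _ => ?_
    simp [Measure.eq_zero_of_isEmpty]
  let m (i : ℕ) : FiniteMeasure X := ⟨sfiniteSeq ν i, inferInstance⟩
  refine ⟨_, inferInstance, Measure.infinitePi fun i =>
    poissonPoints (m i).mass ((m i).normalize : Measure X), superposition, inferInstance,
    measurable_superposition, .of_laplace measurable_superposition (Eventually.of_forall
      fun ω A hA => exists_superposition_apply_eq_toENNReal ω hA) fun f hf => ?_⟩
  rw [lintegral_expNeg_superposition m hf]
  conv_rhs => rw [← sum_sfiniteSeq ν, lintegral_sum_measure]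
  rfl

end Construction

section Counting

lemma mem_range_toENNReal_of_tendsto {u : ℕ → ℝ≥0∞} {a : ℝ≥0∞}
    (hu : ∀ n, u n ∈ Set.range ENat.toENNReal) (ha : Tendsto u atTop (𝓝 a)) :
    a ∈ Set.range ENat.toENNReal :=
  ENat.isClosedEmbedding_toENNReal.isClosed_range.mem_of_tendsto ha (Eventually.of_forall hu)

lemma tsum_mem_range_toENNReal {u : ℕ → ℝ≥0∞} (hu : ∀ n, u n ∈ Set.range ENat.toENNReal) :
    ∑' n, u n ∈ Set.range ENat.toENNReal := by
  refine mem_range_toENNReal_of_tendsto (fun n => ?_) (ENNReal.tendsto_nat_tsum u)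
  induction n with
  | zero => exact ⟨0, by simp⟩
  | succ n ih =>
    obtain ⟨a, ha⟩ := ih
    obtain ⟨b, hb⟩ := hu n
    exact ⟨a + b, by rw [Finset.sum_range_succ, ENat.toENNReal_add, ha, hb]⟩

variable {X : Type*} {𝒜 : Set (Set X)}

lemma measure_mem_range_toENNReal_of_generateFrom {m : MeasurableSpace X} {μ : Measure X}
    [IsFiniteMeasure μ] (hgen : m = MeasurableSpace.generateFrom 𝒜) (hpi : IsPiSystem 𝒜)
    (huniv : Set.univ ∈ 𝒜) (hint : ∀ A ∈ 𝒜, μ A ∈ Set.range ENat.toENNReal) {A : Set X}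
    (hA : MeasurableSet A) : μ A ∈ Set.range ENat.toENNReal := by
  induction A, hA using MeasurableSpace.induction_on_inter hgen hpi with
  | empty => exact ⟨0, by simp⟩
  | basic A hA => exact hint A hA
  | compl A hA ih =>
    obtain ⟨a, ha⟩ := ih
    obtain ⟨b, hb⟩ := hint _ huniv
    exact ⟨b - a, by rw [ENat.toENNReal_sub, ha, hb, measure_compl hA (measure_ne_top μ A)]⟩
  | iUnion f hd hf ih =>
    rw [measure_iUnion hd hf]
    exact tsum_mem_range_toENNReal ih

lemma measure_mem_range_toENNReal_of_disjointed {m : MeasurableSpace X} {μ : Measure X}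
    (hgen : m = MeasurableSpace.generateFrom 𝒜) (hpi : IsPiSystem 𝒜) (huniv : Set.univ ∈ 𝒜)
    {s : ℕ → Set X} (hs : ∀ i, MeasurableSet (s i)) (hfin : ∀ i, μ (s i) < ∞)
    (hcover : ⋃ i, s i = Set.univ)
    (hint : ∀ i, ∀ A ∈ 𝒜, μ (A ∩ disjointed s i) ∈ Set.range ENat.toENNReal) {A : Set X}
    (hA : MeasurableSet A) : μ A ∈ Set.range ENat.toENNReal := by
  have hsum : μ A = ∑' i, μ.restrict (disjointed s i) A := by
    rw [← Measure.sum_apply _ hA, ← Measure.restrict_iUnion (disjoint_disjointed s)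
      (MeasurableSet.disjointed hs), iUnion_disjointed, hcover, Measure.restrict_univ]
  rw [hsum]
  refine tsum_mem_range_toENNReal fun i => ?_
  have : IsFiniteMeasure (μ.restrict (disjointed s i)) :=
    ⟨by rw [Measure.restrict_apply_univ]
        exact (measure_mono (disjointed_subset s i)).trans_lt (hfin i)⟩
  refine measure_mem_range_toENNReal_of_generateFrom hgen hpi huniv (fun B hB => ?_) hA
  have hBm : MeasurableSet B := hgen ▸ MeasurableSpace.measurableSet_generateFrom hB
  rw [Measure.restrict_apply hBm]
  exact hint i B hB

end Counting

namespace MBase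

section Superlevel

variable {X : Type*} [TopologicalSpace X] {h : ℕ → X →ᵇ ℝ}

/-- The sets `{x | 1 / (n + 1) ≤ h k x}`, enumerated by pairing `k` and `n`. Every measure in
`MBase h` is finite on them. -/
def superlevel (h : ℕ → X →ᵇ ℝ) (i : ℕ) : Set X :=
  {x | 1 / ((i.unpair.2 : ℝ) + 1) ≤ h i.unpair.1 x}

lemma iUnion_superlevel (hpos : ∀ x, ∃ k, 0 < h k x) : ⋃ i, superlevel h i = Set.univ := by
  refine Set.iUnion_eq_univ_iff.mpr fun x => ?_
  obtain ⟨k, hk⟩ := hpos x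
  obtain ⟨n, hn⟩ := exists_nat_one_div_lt hk
  exact ⟨Nat.pair k n, by simpa [superlevel] using hn.le⟩

end Superlevel

variable {X : Type*} [TopologicalSpace X] [MeasurableSpace X] [BorelSpace X] {h : ℕ → X →ᵇ ℝ}

lemma measurableSet_superlevel (i : ℕ) : MeasurableSet (superlevel h i) :=
  (isClosed_le continuous_const (h i.unpair.1).continuous).measurableSet

lemma measure_superlevel_lt_top (ν : MBase h) (i : ℕ) : ν.1 (superlevel h i) < ∞ := by
  have hpos : ENNReal.ofReal (1 / ((i.unpair.2 : ℝ) + 1)) ≠ 0 :=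
    (ENNReal.ofReal_pos.mpr (by positivity)).ne'
  refine (measure_mono fun x hx => ENNReal.ofReal_le_ofReal hx).trans_lt
    ((meas_ge_le_lintegral_div (f := fun x => ENNReal.ofReal (h i.unpair.1 x))
      (Measurable.aemeasurable (by fun_prop)) hpos ENNReal.ofReal_ne_top).trans_lt
      (ENNReal.div_lt_top (ν.2 _).ne hpos))

lemma sigmaFinite (hpos : ∀ x, ∃ k, 0 < h k x) (ν : MBase h) : SigmaFinite ν.1 :=
  ⟨⟨⟨superlevel h, fun _ => trivial, ν.measure_superlevel_lt_top, iUnion_superlevel hpos⟩⟩⟩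

lemma measurableSet_setOf_counting [PolishSpace X] (h0 : ∀ k x, 0 ≤ h k x)
    (hpos : ∀ x, ∃ k, 0 < h k x) :
    MeasurableSet {ν : MBase h | ∀ A, MeasurableSet A → ∃ n : ℕ∞, ν.1 A = (n : ℝ≥0∞)} := by
  let 𝒜 : Set (Set X) := generateSetAlgebra (TopologicalSpace.countableBasis X)
  have halg : IsSetAlgebra 𝒜 := isSetAlgebra_generateSetAlgebra
  have hgen : ‹MeasurableSpace X› = MeasurableSpace.generateFrom 𝒜 := by
    rw [generateFrom_generateSetAlgebra_eq, BorelSpace.measurable_eq (α := X)]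
    exact (TopologicalSpace.isBasis_countableBasis X).borel_eq_generateFrom
  have hpiece (i : ℕ) {A : Set X} (hA : A ∈ 𝒜) :
      MeasurableSet (A ∩ disjointed (superlevel h) i) :=
    .inter (hgen ▸ MeasurableSpace.measurableSet_generateFrom hA)
      (MeasurableSet.disjointed measurableSet_superlevel i)
  have hset : {ν : MBase h | ∀ A, MeasurableSet A → ∃ n : ℕ∞, ν.1 A = (n : ℝ≥0∞)}
      = ⋂ (i : ℕ), ⋂ A ∈ 𝒜,
        {ν : MBase h | ν.1 (A ∩ disjointed (superlevel h) i) ∈ Set.range ENat.toENNReal} := by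
    ext ν
    simp only [Set.mem_iInter, Set.mem_ofPred_eq]
    constructor
    · intro hν i A hA
      obtain ⟨a, ha⟩ := hν _ (hpiece i hA)
      exact ⟨a, ha.symm⟩
    · intro hν A hA
      obtain ⟨a, ha⟩ := measure_mem_range_toENNReal_of_disjointed hgen
        halg.isSetRing.isSetSemiring.isPiSystem halg.univ_mem measurableSet_superlevel
        ν.measure_superlevel_lt_top (iUnion_superlevel hpos) hν hA
      exact ⟨a, ha.symm⟩
  rw [hset]
  refine MeasurableSet.iInter fun i => MeasurableSet.biInter
    (countable_generateSetAlgebra (TopologicalSpace.countable_countableBasis X)) fun A hA => ?_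
  exact ((Measure.measurable_coe (hpiece i hA)).comp (measurable_val h0 hpos))
    ENat.isClosedEmbedding_toENNReal.isClosed_range.measurableSet

end MBase

section HalfLine

lemma lebesgueHalfLine_Iic (K : ℝ≥0) : lebesgueHalfLine (Set.Iic K) = K := by
  have hemb : MeasurableEmbedding fun u : ℝ≥0 => (u : ℝ) :=
    MeasurableEmbedding.subtype_coe measurableSet_Ici
  rw [lebesgueHalfLine, hemb.comap_apply]
  have himage : (fun u : ℝ≥0 => (u : ℝ)) '' Set.Iic K = Set.Icc (0 : ℝ) K := by
    ext r
    constructor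
    · rintro ⟨u, hu, rfl⟩
      exact ⟨u.2, NNReal.coe_le_coe.mpr hu⟩
    · rintro ⟨h0, hK⟩
      exact ⟨⟨r, h0⟩, NNReal.coe_le_coe.mp hK, rfl⟩
  rw [himage, Real.volume_Icc, sub_zero, ENNReal.ofReal_coe_nnreal]

instance : SigmaFinite lebesgueHalfLine := by
  refine ⟨⟨⟨fun n : ℕ => Set.Iic (n : ℝ≥0), fun _ => trivial, fun n => ?_, ?_⟩⟩⟩
  · rw [lebesgueHalfLine_Iic]; exact ENNReal.coe_lt_top
  · exact Set.iUnion_eq_univ_iff.mpr fun u => exists_nat_ge u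

/-- A continuous cutoff function, equal to `1` on `[0, m]` and to `0` on `[m + 1, ∞)`. -/
def cutoff (m : ℕ) : ℝ≥0 →ᵇ ℝ :=
  BoundedContinuousFunction.ofNormedAddCommGroup (fun u => min 1 (max 0 ((m : ℝ) + 1 - u)))
    (by fun_prop) 1 (fun u => by
      rw [Real.norm_of_nonneg (le_min zero_le_one (le_max_left _ _))]
      exact min_le_left _ _)

lemma cutoff_apply (m : ℕ) (u : ℝ≥0) : cutoff m u = min 1 (max 0 ((m : ℝ) + 1 - u)) := rfl

lemma cutoff_nonneg (m : ℕ) (u : ℝ≥0) : 0 ≤ cutoff m u := le_min zero_le_one (le_max_left _ _)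

lemma cutoff_le_one (m : ℕ) (u : ℝ≥0) : cutoff m u ≤ 1 := min_le_left _ _

lemma cutoff_eq_one {m : ℕ} {u : ℝ≥0} (hu : u ≤ m) : cutoff m u = 1 := by
  have : (u : ℝ) ≤ m := by exact_mod_cast hu
  rw [cutoff_apply, max_eq_right (by linarith), min_eq_left (by linarith)]

lemma cutoff_eq_zero {m : ℕ} {u : ℝ≥0} (hu : (m : ℝ≥0) + 1 < u) : cutoff m u = 0 := by
  have : (m : ℝ) + 1 < u := by exact_mod_cast hu
  rw [cutoff_apply, max_eq_left (by linarith), min_eq_right (by linarith)]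

lemma cutoff_le_indicator (m : ℕ) (u : ℝ≥0) :
    cutoff m u ≤ (Set.Iic ((m : ℝ≥0) + 1)).indicator (fun _ => (1 : ℝ)) u := by
  by_cases hu : u ≤ (m : ℝ≥0) + 1
  · rw [Set.indicator_of_mem (Set.mem_Iic.mpr hu)]; exact cutoff_le_one m u
  · rw [Set.indicator_of_notMem (by simpa using hu), cutoff_eq_zero (not_le.mp hu)]

lemma integrable_indicator_Iic (K : ℝ≥0) :
    Integrable ((Set.Iic K).indicator fun _ => (1 : ℝ)) lebesgueHalfLine := by
  rw [integrable_indicator_iff measurableSet_Iic]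
  exact integrableOn_const (by rw [lebesgueHalfLine_Iic]; exact ENNReal.coe_ne_top)

lemma integrable_cutoff (m : ℕ) : Integrable (cutoff m) lebesgueHalfLine := by
  refine (integrable_indicator_Iic ((m : ℝ≥0) + 1)).mono'
    (cutoff m).continuous.aestronglyMeasurable (Eventually.of_forall fun u => ?_)
  rw [Real.norm_of_nonneg (cutoff_nonneg m u)]
  exact cutoff_le_indicator m u

lemma le_integral_cutoff (m : ℕ) : (m : ℝ) ≤ ∫ u, cutoff m u ∂lebesgueHalfLine := by
  have h1 : ∫ u, (Set.Iic (m : ℝ≥0)).indicator (fun _ => (1 : ℝ)) u ∂lebesgueHalfLine = m := by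
    rw [integral_indicator_const _ measurableSet_Iic, Measure.real, lebesgueHalfLine_Iic]
    simp
  rw [← h1]
  refine integral_mono (integrable_indicator_Iic _) (integrable_cutoff m) fun u => ?_
  by_cases hu : u ≤ m
  · rw [Set.indicator_of_mem (Set.mem_Iic.mpr hu), cutoff_eq_one hu]
  · rw [Set.indicator_of_notMem (by simpa using hu)]; exact cutoff_nonneg m u

end HalfLine

lemma tendsto_of_tendsto_map_homeomorph {X Y ι : Type*} [TopologicalSpace X] [MeasurableSpace X]
    [BorelSpace X] [TopologicalSpace Y] [MeasurableSpace Y] [BorelSpace Y] (e : X ≃ₜ Y)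
    {L : Filter ι} {Q : ι → ProbabilityMeasure X} {Q₀ : ProbabilityMeasure X}
    (hQ : Tendsto (fun i => (Q i).map e.continuous.measurable.aemeasurable) L
      (𝓝 (Q₀.map e.continuous.measurable.aemeasurable))) :
    Tendsto Q L (𝓝 Q₀) := by
  have hback (R : ProbabilityMeasure X) : (R.map e.continuous.measurable.aemeasurable).map
      e.symm.continuous.measurable.aemeasurable = R := by
    refine Subtype.ext ?_
    change ((R : Measure X).map e).map e.symm = R
    rw [Measure.map_map e.symm.continuous.measurable e.continuous.measurable]
    simp
  simpa only [hback] using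
    ProbabilityMeasure.tendsto_map_of_tendsto_of_continuous _ _ hQ e.symm.continuous

section Strip

variable {S : Type*} [TopologicalSpace S]

/-- A bounded continuous function on `S`, as a function on `S × [0, ∞)`. -/
def onStrip (φ : S →ᵇ ℝ) : (S × ℝ≥0) →ᵇ ℝ := φ.compContinuous ⟨Prod.fst, continuous_fst⟩

@[simp] lemma onStrip_apply (φ : S →ᵇ ℝ) (p : S × ℝ≥0) : onStrip φ p = φ p.1 := rfl

/-- The function `cutoff m` of the second coordinate, as a function on `S × [0, ∞)`. -/
def stripCutoff (S : Type*) [TopologicalSpace S] (m : ℕ) : (S × ℝ≥0) →ᵇ ℝ :=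
  (cutoff m).compContinuous ⟨Prod.snd, continuous_snd⟩

@[simp] lemma stripCutoff_apply (m : ℕ) (p : S × ℝ≥0) : stripCutoff S m p = cutoff m p.2 := rfl

/-- The weights `(x, u) ↦ h k x * cutoff m u`, enumerated by pairing `k` and `m`. They present the
measures on the strip as an instance of `MBase`. -/
def stripWeight (h : ℕ → S →ᵇ ℝ) (n : ℕ) : (S × ℝ≥0) →ᵇ ℝ :=
  onStrip (h n.unpair.1) * stripCutoff S n.unpair.2

lemma stripWeight_apply (h : ℕ → S →ᵇ ℝ) (n : ℕ) (p : S × ℝ≥0) :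
    stripWeight h n p = h n.unpair.1 p.1 * cutoff n.unpair.2 p.2 := rfl

variable {h : ℕ → S →ᵇ ℝ}

lemma stripWeight_nonneg (h0 : ∀ k x, 0 ≤ h k x) (n : ℕ) (p : S × ℝ≥0) : 0 ≤ stripWeight h n p :=
  mul_nonneg (h0 _ _) (cutoff_nonneg _ _)

lemma exists_stripWeight_pos (hpos : ∀ x, ∃ k, 0 < h k x) (p : S × ℝ≥0) :
    ∃ n, 0 < stripWeight h n p := by
  obtain ⟨k, hk⟩ := hpos p.1
  obtain ⟨m, hm⟩ := exists_nat_ge p.2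
  refine ⟨Nat.pair k m, ?_⟩
  rw [stripWeight_apply, Nat.unpair_pair, cutoff_eq_one hm, mul_one]
  exact hk

variable [MeasurableSpace S] [BorelSpace S]

/-- A measure on the strip belongs to `MStrip h` if and only if it belongs to `MBase` for the
weights `stripWeight h`. -/
def MStrip.equivBase (h0 : ∀ k x, 0 ≤ h k x) : MStrip h ≃ MBase (stripWeight h) where
  toFun μ := ⟨μ.1, fun n => by
    refine lt_of_le_of_lt ?_ (μ.2 n.unpair.1 ((n.unpair.2 : ℝ≥0) + 1))
    rw [← lintegral_indicator (MeasurableSet.univ.prod measurableSet_Iic)]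
    refine lintegral_mono fun p => ?_
    by_cases hp : p.2 ≤ (n.unpair.2 : ℝ≥0) + 1
    · have hmem : p ∈ Set.univ ×ˢ Set.Iic ((n.unpair.2 : ℝ≥0) + 1) := ⟨trivial, hp⟩
      rw [Set.indicator_of_mem hmem, stripWeight_apply]
      exact ENNReal.ofReal_le_ofReal (mul_le_of_le_one_right (h0 _ _) (cutoff_le_one _ _))
    · rw [stripWeight_apply, cutoff_eq_zero (not_le.mp hp)]
      simp⟩
  invFun μ := ⟨μ.1, fun k K => by
    obtain ⟨m, hm⟩ := exists_nat_ge K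
    refine lt_of_le_of_lt ?_ (μ.2 (Nat.pair k m))
    rw [← lintegral_indicator (MeasurableSet.univ.prod measurableSet_Iic)]
    refine lintegral_mono fun p => ?_
    by_cases hp : p.2 ≤ K
    · have hmem : p ∈ Set.univ ×ˢ Set.Iic K := ⟨trivial, hp⟩
      rw [Set.indicator_of_mem hmem, stripWeight_apply, Nat.unpair_pair,
        cutoff_eq_one (hp.trans hm), mul_one]
    · rw [Set.indicator_of_notMem fun hmem => hp hmem.2]
      exact zero_le⟩
  left_inv _ := rfl
  right_inv _ := rfl

/-- The space `MStrip h` is `MBase (stripWeight h)`, topologically as well. -/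
def MStrip.homeoBase (h0 : ∀ k x, 0 ≤ h k x) : MStrip h ≃ₜ MBase (stripWeight h) where
  toEquiv := MStrip.equivBase h0
  continuous_toFun := by
    refine continuous_induced_rng.mpr (continuous_pi fun q => ?_)
    have hcont : Continuous fun (μ : MStrip h) (q : ℕ × StripTest S) =>
      ∫ p, q.2.1 p * h q.1 p.1 ∂μ.1 := continuous_induced_dom
    let f : StripTest S := ⟨q.2 * stripCutoff S q.1.unpair.2, (q.1.unpair.2 : ℝ≥0) + 1,
      fun x u hu => by simp [cutoff_eq_zero hu]⟩
    convert (continuous_apply (q.1.unpair.1, f)).comp hcont using 2 with μ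
    refine integral_congr_ae (Eventually.of_forall fun p => ?_)
    simp only [f, stripWeight_apply, BoundedContinuousFunction.coe_mul, Pi.mul_apply,
      stripCutoff_apply]
    ring
  continuous_invFun := by
    refine continuous_induced_rng.mpr (continuous_pi fun q => ?_)
    obtain ⟨K, hK⟩ := q.2.2
    obtain ⟨m, hm⟩ := exists_nat_ge K
    convert MBase.continuous_integral_mul_weight (h := stripWeight h) (Nat.pair q.1 m) q.2.1
      using 2 with μ
    refine integral_congr_ae (Eventually.of_forall fun p => ?_)
    simp only [stripWeight_apply, Nat.unpair_pair]
    by_cases hp : p.2 ≤ K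
    · rw [cutoff_eq_one (hp.trans hm), mul_one]
    · rw [show q.2.1 p = 0 from hK p.1 p.2 (not_le.mp hp), zero_mul, zero_mul]

/-- The integrand `μ ↦ exp (-∫ f dμ)` of the Laplace functional on the strip. -/
def MStrip.laplace (h0 : ∀ k x, 0 ≤ h k x) (f : testCone (stripWeight h)) : MStrip h →ᵇ ℝ :=
  (MBase.laplace (stripWeight_nonneg h0) f).compContinuous
    ⟨MStrip.homeoBase h0, (MStrip.homeoBase h0).continuous⟩

lemma MStrip.laplace_apply (h0 : ∀ k x, 0 ≤ h k x) (f : testCone (stripWeight h)) (μ : MStrip h) :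
    MStrip.laplace h0 f μ = Real.exp (-∫ p, f.1 p ∂μ.1) := rfl

lemma MStrip.integral_laplace_map (h0 : ∀ k x, 0 ≤ h k x) (f : testCone (stripWeight h))
    (Q : ProbabilityMeasure (MStrip h)) :
    ∫ ν, MBase.laplace (stripWeight_nonneg h0) f ν
        ∂(Q.map (MStrip.homeoBase h0).continuous.measurable.aemeasurable : Measure _)
      = ∫ μ, MStrip.laplace h0 f μ ∂(Q : Measure (MStrip h)) := by
  rw [ProbabilityMeasure.toMeasure_map, integral_map
    (MStrip.homeoBase h0).continuous.measurable.aemeasurable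
    (MBase.laplace (stripWeight_nonneg h0) f).continuous.aestronglyMeasurable]
  rfl

lemma MStrip.integrable_of_mem_testCone (h0 : ∀ k x, 0 ≤ h k x) (μ : MStrip h)
    {f : (S × ℝ≥0) →ᵇ ℝ} (hf : f ∈ testCone (stripWeight h)) : Integrable f μ.1 :=
  MBase.integrable_of_mem_testCone (stripWeight_nonneg h0) (MStrip.homeoBase h0 μ) hf

variable [PolishSpace S]

lemma MStrip.metrizableSpace (h0 : ∀ k x, 0 ≤ h k x) (hpos : ∀ x, ∃ k, 0 < h k x) :
    TopologicalSpace.MetrizableSpace (MStrip h) :=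
  have := MBase.metrizableSpace (stripWeight_nonneg h0) (exists_stripWeight_pos hpos)
  (MStrip.homeoBase h0).isEmbedding.metrizableSpace

lemma MStrip.measurable_val (h0 : ∀ k x, 0 ≤ h k x) (hpos : ∀ x, ∃ k, 0 < h k x) :
    Measurable fun μ : MStrip h => μ.1 :=
  (MBase.measurable_val (stripWeight_nonneg h0) (exists_stripWeight_pos hpos)).comp
    (MStrip.homeoBase h0).continuous.measurable

lemma MStrip.measurable_of_measurable_val (h0 : ∀ k x, 0 ≤ h k x) {Ω : Type*} [MeasurableSpace Ω]
    {Y : Ω → MStrip h} (hY : Measurable fun ω => (Y ω).1) : Measurable Y :=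
  (MStrip.homeoBase h0).symm.continuous.measurable.comp
    (MBase.measurable_of_measurable_val (stripWeight_nonneg h0)
      (Y := fun ω => MStrip.homeoBase h0 (Y ω)) hY)

lemma MStrip.measurableSet_setOf_counting (h0 : ∀ k x, 0 ≤ h k x) (hpos : ∀ x, ∃ k, 0 < h k x) :
    MeasurableSet {μ : MStrip h | ∀ A, MeasurableSet A → ∃ n : ℕ∞, μ.1 A = (n : ℝ≥0∞)} :=
  (MStrip.homeoBase h0).continuous.measurable (MBase.measurableSet_setOf_counting
    (stripWeight_nonneg h0) (exists_stripWeight_pos hpos))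

lemma MStrip.tendsto_of_laplace (h0 : ∀ k x, 0 ≤ h k x) {ι : Type*} {L : Filter ι}
    [L.IsCountablyGenerated] {Q : ι → ProbabilityMeasure (MStrip h)}
    {Q₀ : ProbabilityMeasure (MStrip h)}
    (hQ : ∀ f : testCone (stripWeight h),
      Tendsto (fun i => ∫ μ, MStrip.laplace h0 f μ ∂(Q i : Measure (MStrip h))) L
        (𝓝 (∫ μ, MStrip.laplace h0 f μ ∂(Q₀ : Measure (MStrip h))))) :
    Tendsto Q L (𝓝 Q₀) :=
  tendsto_of_tendsto_map_homeomorph (MStrip.homeoBase h0)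
    (MBase.tendsto_of_laplace (stripWeight_nonneg h0) fun f => by
      simpa only [MStrip.integral_laplace_map] using hQ f)

end Strip

section StripTransform

lemma exists_continuousOn_mul_eq {F : ℝ → ℝ} (hF0 : F 0 = 0) {s : Set ℝ} (hs : s ∈ 𝓝 0)
    (hcont : ContinuousOn F s) (hdiff : DifferentiableAt ℝ F 0)
    (hnonneg : ∀ t ∈ s, 0 ≤ t → 0 ≤ F t) :
    ∃ ρ : ℝ → ℝ, ContinuousOn ρ s ∧ (∀ t, 0 ≤ ρ t) ∧ ∀ t ∈ s, 0 ≤ t → ρ t * t = F t := by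
  refine ⟨fun t => |dslope F 0 t|, ((continuousOn_dslope hs).mpr ⟨hcont, hdiff⟩).abs,
    fun t => abs_nonneg _, fun t hts ht => ?_⟩
  have hslope : t * dslope F 0 t = F t := by simpa [hF0] using sub_smul_dslope F 0 t
  calc |dslope F 0 t| * t = |t * dslope F 0 t| := by rw [abs_mul, abs_of_nonneg ht, mul_comm]
    _ = F t := by rw [hslope, abs_of_nonneg (hnonneg t hts ht)]

lemma exists_boundedContinuousFunction_mul_eq {F : ℝ → ℝ} (hF0 : F 0 = 0) {s : Set ℝ}
    (hs : s ∈ 𝓝 0) (hcont : ContinuousOn F s) (hdiff : DifferentiableAt ℝ F 0)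
    (hnonneg : ∀ t ∈ s, 0 ≤ t → 0 ≤ F t) {X : Type*} [TopologicalSpace X] (f : X →ᵇ ℝ) {b : ℝ}
    (hf : ∀ x, f x ∈ Set.Icc 0 b) (hb : Set.Icc 0 b ⊆ s) :
    ∃ r : X →ᵇ ℝ, (∀ x, 0 ≤ r x) ∧ ∀ x, r x * f x = F (f x) := by
  obtain ⟨ρ, hρ, hρ0, hρF⟩ := exists_continuousOn_mul_eq hF0 hs hcont hdiff hnonneg
  obtain ⟨C, hC⟩ := (isCompact_Icc.image_of_continuousOn (hρ.mono hb)).isBounded.exists_norm_le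
  exact ⟨BoundedContinuousFunction.ofNormedAddCommGroup (fun x => ρ (f x))
    ((hρ.mono hb).comp_continuous f.continuous hf) C fun x => hC _ ⟨_, hf x, rfl⟩,
    fun x => hρ0 _, fun x => hρF _ (hb (hf x)) (hf x).1⟩

variable {S : Type*} [TopologicalSpace S] {h : ℕ → S →ᵇ ℝ}

lemma onStrip_mul_stripCutoff_mem_testCone {ψ : S →ᵇ ℝ} (hψ : ψ ∈ testCone h) (m : ℕ) :
    onStrip ψ * stripCutoff S m ∈ testCone (stripWeight h) := by
  induction hψ using AddSubmonoid.closure_induction with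
  | mem ψ hψ =>
    obtain ⟨k, φ, hφ, rfl⟩ := hψ
    have hfactor : onStrip (φ * h k) * stripCutoff S m
        = onStrip φ * stripWeight h (Nat.pair k m) := by
      ext p
      simp [stripWeight_apply, mul_assoc]
    rw [hfactor]
    exact mul_weight_mem_testCone _ fun p => hφ p.1
  | zero =>
    have hzero : onStrip (0 : S →ᵇ ℝ) * stripCutoff S m = 0 := by ext p; simp
    rw [hzero]
    exact zero_mem _
  | add φ φ' _ _ ih ih' =>
    have hadd : onStrip (φ + φ') * stripCutoff S m
        = onStrip φ * stripCutoff S m + onStrip φ' * stripCutoff S m := by ext p; simp [add_mul]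
    rw [hadd]
    exact add_mem ih ih'

/-- The function `ψ` on `S`, spread over `S × [0, ∞)` with a density proportional to `cutoff m`, so
that integration over `[0, ∞)` recovers `ψ`. -/
def spread (ψ : S →ᵇ ℝ) (m : ℕ) : (S × ℝ≥0) →ᵇ ℝ :=
  BoundedContinuousFunction.const _ (∫ u, cutoff m u ∂lebesgueHalfLine)⁻¹
    * (onStrip ψ * stripCutoff S m)

lemma spread_apply (ψ : S →ᵇ ℝ) (m : ℕ) (p : S × ℝ≥0) :
    spread ψ m p = (∫ u, cutoff m u ∂lebesgueHalfLine)⁻¹ * (ψ p.1 * cutoff m p.2) := rfl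

lemma inv_integral_cutoff_nonneg (m : ℕ) : 0 ≤ (∫ u, cutoff m u ∂lebesgueHalfLine)⁻¹ :=
  inv_nonneg.mpr (integral_nonneg (cutoff_nonneg m))

lemma spread_mem_testCone {ψ : S →ᵇ ℝ} (hψ : ψ ∈ testCone h) (m : ℕ) :
    spread ψ m ∈ testCone (stripWeight h) :=
  mul_mem_testCone (fun _ => inv_integral_cutoff_nonneg m)
    (onStrip_mul_stripCutoff_mem_testCone hψ m)

lemma spread_mono {ψ ψ' : S →ᵇ ℝ} (hψ : ∀ x, ψ x ≤ ψ' x) (m : ℕ) (p : S × ℝ≥0) :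
    spread ψ m p ≤ spread ψ' m p :=
  mul_le_mul_of_nonneg_left (mul_le_mul_of_nonneg_right (hψ p.1) (cutoff_nonneg m p.2))
    (inv_integral_cutoff_nonneg m)

lemma spread_mem_Icc {ψ : S →ᵇ ℝ} {m : ℕ} (hm : 0 < m) (hψ0 : ∀ x, 0 ≤ ψ x)
    (hψm : ∀ x, 2 * ψ x ≤ m) (p : S × ℝ≥0) : spread ψ m p ∈ Set.Icc (0 : ℝ) (1 / 2) := by
  have hmass := le_integral_cutoff m
  have hm' : (0 : ℝ) < m := by exact_mod_cast hm
  refine ⟨mul_nonneg (inv_integral_cutoff_nonneg m)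
    (mul_nonneg (hψ0 p.1) (cutoff_nonneg m p.2)), ?_⟩
  rw [spread_apply, inv_mul_le_iff₀ (hm'.trans_le hmass)]
  linarith [mul_le_of_le_one_right (hψ0 p.1) (cutoff_le_one m p.2), hψm p.1]

lemma integrable_spread (ψ : S →ᵇ ℝ) (m : ℕ) (x : S) :
    Integrable (fun u => spread ψ m (x, u)) lebesgueHalfLine := by
  simp only [spread_apply]
  exact ((integrable_cutoff m).const_mul _).const_mul _

lemma integral_spread (ψ : S →ᵇ ℝ) {m : ℕ} (hm : 0 < m) (x : S) :
    ∫ u, spread ψ m (x, u) ∂lebesgueHalfLine = ψ x := by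
  have hm' : (0 : ℝ) < m := by exact_mod_cast hm
  have hmass : ∫ u, cutoff m u ∂lebesgueHalfLine ≠ 0 := (hm'.trans_le (le_integral_cutoff m)).ne'
  simp only [spread_apply, integral_const_mul]
  field_simp

/-- The relation `ψ x = ∫ (1 - exp (-f (x, u))) du`, under which a Poisson random measure with mean
measure `ν × Λ` has Laplace functional `exp (-∫ ψ dν)` at `f`. -/
def IsStripTransform (f : (S × ℝ≥0) →ᵇ ℝ) (ψ : S →ᵇ ℝ) : Prop :=
  ∀ x, Integrable (fun u => 1 - Real.exp (-f (x, u))) lebesgueHalfLine ∧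
    ψ x = ∫ u, (1 - Real.exp (-f (x, u))) ∂lebesgueHalfLine

lemma exists_isStripTransform_neg_log {ψ : S →ᵇ ℝ} (hψ : ψ ∈ testCone h) {m : ℕ} (hm : 0 < m)
    (hψ0 : ∀ x, 0 ≤ ψ x) (hψm : ∀ x, 2 * ψ x ≤ m) :
    ∃ f : testCone (stripWeight h), IsStripTransform f.1 ψ ∧
      ∀ p, f.1 p = -Real.log (1 - spread ψ m p) := by
  have hIcc := spread_mem_Icc hm hψ0 hψm
  have hdiff : DifferentiableOn ℝ (fun s : ℝ => -Real.log (1 - s)) (Set.Iio 1) := fun t ht =>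
    (((differentiableAt_id.const_sub 1).log (sub_pos.mpr ht).ne').neg).differentiableWithinAt
  have hnhds : Set.Iio (1 : ℝ) ∈ 𝓝 0 := Iio_mem_nhds one_pos
  obtain ⟨r, hr0, hr⟩ := exists_boundedContinuousFunction_mul_eq
    (F := fun s => -Real.log (1 - s)) (by simp) hnhds hdiff.continuousOn
    (hdiff.differentiableAt hnhds)
    (fun t ht1 ht => neg_nonneg.mpr (Real.log_nonpos (sub_pos.mpr ht1).le (sub_le_self 1 ht)))
    (spread ψ m) hIcc fun t ht => ht.2.trans_lt (by norm_num)
  refine ⟨⟨r * spread ψ m, mul_mem_testCone hr0 (spread_mem_testCone hψ m)⟩, fun x => ?_, hr⟩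
  have hexp (u : ℝ≥0) : 1 - Real.exp (-(r * spread ψ m) (x, u)) = spread ψ m (x, u) := by
    rw [BoundedContinuousFunction.mul_apply, hr, neg_neg,
      Real.exp_log (by linarith [(hIcc (x, u)).2]), sub_sub_cancel]
  simp only [hexp]
  exact ⟨integrable_spread ψ m x, (integral_spread ψ hm x).symm⟩

lemma exists_nat_forall_two_mul_le (ψ : S →ᵇ ℝ) : ∃ m : ℕ, 0 < m ∧ ∀ x, 2 * ψ x ≤ m := by
  obtain ⟨m, hm⟩ := exists_nat_ge (2 * ‖ψ‖)
  refine ⟨m + 1, m.succ_pos, fun x => ?_⟩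
  push_cast
  linarith [(le_abs_self _).trans (ψ.norm_coe_le_norm x)]

lemma exists_isStripTransform_of_base (h0 : ∀ k x, 0 ≤ h k x) (ψ : testCone h) :
    ∃ f : testCone (stripWeight h), IsStripTransform f.1 ψ.1 := by
  obtain ⟨m, hm, hψm⟩ := exists_nat_forall_two_mul_le ψ.1
  obtain ⟨f, hf, -⟩ :=
    exists_isStripTransform_neg_log ψ.2 hm (nonneg_of_mem_testCone h0 ψ.2) hψm
  exact ⟨f, hf⟩

variable [FirstCountableTopology S]

lemma exists_testCone_integral_mul_stripWeight {g : (S × ℝ≥0) →ᵇ ℝ} (hg : ∀ p, 0 ≤ g p) (n : ℕ) :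
    ∃ ψ ∈ testCone h, ∀ x,
      Integrable (fun u => (g * stripWeight h n) (x, u)) lebesgueHalfLine ∧
      ψ x = ∫ u, (g * stripWeight h n) (x, u) ∂lebesgueHalfLine := by
  set k := n.unpair.1
  set m := n.unpair.2
  have hnorm (x : S) (u : ℝ≥0) : ‖g (x, u) * cutoff m u‖ ≤ ‖g‖ * cutoff m u := by
    rw [norm_mul, Real.norm_of_nonneg (cutoff_nonneg m u)]
    exact mul_le_mul_of_nonneg_right (g.norm_coe_le_norm (x, u)) (cutoff_nonneg m u)
  have hbound : Integrable (fun u => ‖g‖ * cutoff m u) lebesgueHalfLine :=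
    (integrable_cutoff m).const_mul _
  have hmeas (x : S) : AEStronglyMeasurable (fun u => g (x, u) * cutoff m u) lebesgueHalfLine :=
    Continuous.aestronglyMeasurable (by fun_prop)
  have hcont : Continuous fun x => ∫ u, g (x, u) * cutoff m u ∂lebesgueHalfLine :=
    continuous_of_dominated hmeas (fun x => Eventually.of_forall (hnorm x)) hbound
      (Eventually.of_forall fun u => by fun_prop)
  let a : S →ᵇ ℝ := BoundedContinuousFunction.ofNormedAddCommGroup _ hcont
    (∫ u, ‖g‖ * cutoff m u ∂lebesgueHalfLine) fun x =>
      norm_integral_le_of_norm_le hbound (Eventually.of_forall (hnorm x))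
  have hfactor (x : S) : (fun u => (g * stripWeight h n) (x, u))
      = fun u => g (x, u) * cutoff m u * h k x := by
    ext u
    rw [BoundedContinuousFunction.mul_apply, stripWeight_apply, mul_comm (h _ _), mul_assoc]
  refine ⟨a * h k, mul_weight_mem_testCone k fun x => integral_nonneg fun u =>
    mul_nonneg (hg _) (cutoff_nonneg m u), fun x => ?_⟩
  rw [hfactor]
  exact ⟨(hbound.mono' (hmeas x) (Eventually.of_forall (hnorm x))).mul_const _,
    (integral_mul_const _ _).symm⟩

lemma exists_testCone_integral {f : (S × ℝ≥0) →ᵇ ℝ} (hf : f ∈ testCone (stripWeight h)) :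
    ∃ ψ ∈ testCone h, ∀ x, Integrable (fun u => f (x, u)) lebesgueHalfLine ∧
      ψ x = ∫ u, f (x, u) ∂lebesgueHalfLine := by
  induction hf using AddSubmonoid.closure_induction with
  | mem f hf =>
    obtain ⟨n, g, hg, rfl⟩ := hf
    exact exists_testCone_integral_mul_stripWeight hg n
  | zero => exact ⟨0, zero_mem _, fun x => by simp⟩
  | add f f' _ _ ih ih' =>
    obtain ⟨ψ, hψ, hψf⟩ := ih
    obtain ⟨ψ', hψ', hψf'⟩ := ih'
    refine ⟨ψ + ψ', add_mem hψ hψ', fun x => ⟨(hψf x).1.add (hψf' x).1, ?_⟩⟩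
    simp only [BoundedContinuousFunction.add_apply]
    rw [integral_add (hψf x).1 (hψf' x).1, (hψf x).2, (hψf' x).2]

lemma exists_isStripTransform_of_strip (h0 : ∀ k x, 0 ≤ h k x) (f : testCone (stripWeight h)) :
    ∃ ψ : testCone h, IsStripTransform f.1 ψ.1 := by
  have hf0 := nonneg_of_mem_testCone (stripWeight_nonneg h0) f.2
  obtain ⟨r, hr0, hr⟩ := exists_boundedContinuousFunction_mul_eq
    (F := fun t => 1 - Real.exp (-t)) (by simp) univ_mem (by fun_prop) (by fun_prop)
    (fun t _ ht => sub_nonneg.mpr (Real.exp_le_one_iff.mpr (neg_nonpos.mpr ht)))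
    f.1 (fun p => ⟨hf0 p, (le_abs_self _).trans (f.1.norm_coe_le_norm p)⟩) (Set.subset_univ _)
  obtain ⟨ψ, hψ, hψf⟩ := exists_testCone_integral (mul_mem_testCone hr0 f.2)
  refine ⟨⟨ψ, hψ⟩, fun x => ?_⟩
  simp only [← hr]
  exact hψf x

end StripTransform

section PoissonIntegrals

lemma one_sub_expNeg_ofReal {r : ℝ} (hr : 0 ≤ r) :
    1 - expNeg (ENNReal.ofReal r) = ENNReal.ofReal (1 - Real.exp (-r)) := by
  rw [expNeg_ofReal hr, ENNReal.ofReal_sub _ (Real.exp_pos _).le, ENNReal.ofReal_one]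

lemma one_sub_expNeg_le (y : ℝ≥0∞) : 1 - expNeg y ≤ y := by
  rcases eq_or_ne y ∞ with rfl | hy
  · exact le_top
  · rw [← ENNReal.ofReal_toReal hy, one_sub_expNeg_ofReal ENNReal.toReal_nonneg]
    exact ENNReal.ofReal_le_ofReal (by linarith [Real.add_one_le_exp (-y.toReal)])

namespace IsPoissonRandomMeasure

variable {Ω X : Type*} [MeasurableSpace Ω] [MeasurableSpace X] {P : Measure Ω}
  [IsProbabilityMeasure P] {N : Ω → Measure X} {ν : Measure X} [SigmaFinite ν]

lemma expNeg_mul_lintegral_le (hN : IsPoissonRandomMeasure P N ν) (hmeas : Measurable N)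
    {f : X → ℝ≥0∞} (hf : Measurable f) {t : ℝ≥0∞} (ht : t ≠ 0) :
    expNeg (t * ∫⁻ x, f x ∂ν) ≤ P {ω | ∫⁻ x, f x ∂N ω < ∞} := by
  have hfinite : MeasurableSet {ω | ∫⁻ x, f x ∂N ω < ∞} :=
    measurableSet_lt ((Measure.measurable_lintegral hf).comp hmeas) measurable_const
  calc expNeg (t * ∫⁻ x, f x ∂ν)
      ≤ expNeg (∫⁻ x, (1 - expNeg (t * f x)) ∂ν) := by
        refine strictAnti_expNeg.antitone ?_
        rw [← lintegral_const_mul _ hf]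
        exact lintegral_mono fun x => one_sub_expNeg_le _
    _ = ∫⁻ ω, expNeg (∫⁻ x, t * f x ∂N ω) ∂P :=
        (hN.lintegral_expNeg hmeas (hf.const_mul _)).symm
    _ ≤ ∫⁻ ω, {ω | ∫⁻ x, f x ∂N ω < ∞}.indicator 1 ω ∂P := by
        refine lintegral_mono fun ω => ?_
        by_cases hω : ∫⁻ x, f x ∂N ω < ∞
        · rw [Set.indicator_of_mem (s := {ω | ∫⁻ x, f x ∂N ω < ∞}) hω]
          exact expNeg_le_one _
        · rw [lintegral_const_mul _ hf, not_lt_top_iff.mp hω, ENNReal.mul_top ht, expNeg_top]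
          exact zero_le
    _ = P {ω | ∫⁻ x, f x ∂N ω < ∞} := lintegral_indicator_one hfinite

lemma ae_lintegral_lt_top (hN : IsPoissonRandomMeasure P N ν) (hmeas : Measurable N)
    {f : X → ℝ≥0∞} (hf : Measurable f) (hfin : ∫⁻ x, f x ∂ν ≠ ∞) :
    ∀ᵐ ω ∂P, ∫⁻ x, f x ∂N ω < ∞ := by
  have hlim : Tendsto (fun j : ℕ => expNeg ((j : ℝ≥0∞)⁻¹ * ∫⁻ x, f x ∂ν)) atTop (𝓝 1) := by
    have hmul := ENNReal.Tendsto.mul_const ENNReal.tendsto_inv_nat_nhds_zero (Or.inr hfin)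
    simpa [Function.comp_def] using (continuous_expNeg.tendsto _).comp hmul
  have hone : P {ω | ∫⁻ x, f x ∂N ω < ∞} = 1 :=
    le_antisymm prob_le_one <| le_of_tendsto' hlim fun j =>
      hN.expNeg_mul_lintegral_le hmeas hf (ENNReal.inv_ne_zero.mpr (ENNReal.natCast_ne_top j))
  exact (mem_ae_iff_prob_eq_one (measurableSet_lt
    ((Measure.measurable_lintegral hf).comp hmeas) measurable_const)).mpr hone

lemma map_of_ae_eq (hN : IsPoissonRandomMeasure P N ν) (hmeas : Measurable N) {E : Type*}
    [MeasurableSpace E] {M : E → Measure X} (hM : Measurable M)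
    (hcount : MeasurableSet {e | ∀ A, MeasurableSet A → ∃ n : ℕ∞, M e A = (n : ℝ≥0∞)})
    {Y : Ω → E} (hY : Measurable Y) (hYN : ∀ᵐ ω ∂P, M (Y ω) = N ω) :
    IsPoissonRandomMeasure (P.map Y) M ν := by
  have := Measure.isProbabilityMeasure_map (μ := P) hY.aemeasurable
  refine .of_laplace hM ((ae_map_iff hY.aemeasurable hcount).mpr ?_) fun f hf => ?_
  · filter_upwards [hYN, hN.counting] with ω hω hcountω
    rwa [hω]
  · have hexp : Measurable fun e => expNeg (∫⁻ x, f x ∂M e) :=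
      measurable_expNeg.comp ((Measure.measurable_lintegral hf).comp hM)
    rw [lintegral_map hexp hY, ← hN.lintegral_expNeg hmeas hf]
    refine lintegral_congr_ae ?_
    filter_upwards [hYN] with ω hω
    rw [hω]

end IsPoissonRandomMeasure

end PoissonIntegrals

section PoissonStrip

variable {S : Type u} [TopologicalSpace S] [MeasurableSpace S] [BorelSpace S] {h : ℕ → S →ᵇ ℝ}

lemma MBase.lintegral_stripWeight_prod_ne_top (ν : MBase h) (h0 : ∀ k x, 0 ≤ h k x) (n : ℕ) :
    ∫⁻ p, ENNReal.ofReal (stripWeight h n p) ∂ν.1.prod lebesgueHalfLine ≠ ∞ := by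
  simp only [stripWeight_apply, ENNReal.ofReal_mul (h0 _ _)]
  rw [lintegral_prod_mul (f := fun x => ENNReal.ofReal (h n.unpair.1 x))
    (g := fun u => ENNReal.ofReal (cutoff n.unpair.2 u))
    (h n.unpair.1).continuous.measurable.ennreal_ofReal.aemeasurable
    (cutoff n.unpair.2).continuous.measurable.ennreal_ofReal.aemeasurable]
  exact ENNReal.mul_ne_top (ν.2 _).ne (integrable_cutoff n.unpair.2).lintegral_lt_top.ne

lemma IsStripTransform.lintegral_one_sub_expNeg {f : (S × ℝ≥0) →ᵇ ℝ} {ψ : S →ᵇ ℝ}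
    (hfψ : IsStripTransform f ψ) (hf : ∀ p, 0 ≤ f p) {ν : Measure S} (hψ : Integrable ψ ν) :
    ∫⁻ p, (1 - expNeg (ENNReal.ofReal (f p))) ∂ν.prod lebesgueHalfLine
      = ENNReal.ofReal (∫ x, ψ x ∂ν) := by
  have hexp (p : S × ℝ≥0) : 0 ≤ 1 - Real.exp (-f p) :=
    sub_nonneg.mpr (Real.exp_le_one_iff.mpr (neg_nonpos.mpr (hf p)))
  have hψ0 (x : S) : 0 ≤ ψ x := (hfψ x).2 ▸ integral_nonneg fun u => hexp (x, u)
  simp only [one_sub_expNeg_ofReal (hf _)]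
  rw [lintegral_prod _ (by fun_prop),
    ofReal_integral_eq_lintegral_ofReal hψ (Eventually.of_forall hψ0)]
  refine lintegral_congr fun x => ?_
  rw [(hfψ x).2, ofReal_integral_eq_lintegral_ofReal (hfψ x).1
    (Eventually.of_forall fun u => hexp (x, u))]

lemma MStrip.ofReal_laplace (h0 : ∀ k x, 0 ≤ h k x) (f : testCone (stripWeight h))
    (μ : MStrip h) :
    ENNReal.ofReal (MStrip.laplace h0 f μ) = expNeg (∫⁻ p, ENNReal.ofReal (f.1 p) ∂μ.1) := by
  have hf0 := nonneg_of_mem_testCone (stripWeight_nonneg h0) f.2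
  rw [← ofReal_integral_eq_lintegral_ofReal (MStrip.integrable_of_mem_testCone h0 μ f.2)
    (Eventually.of_forall hf0), expNeg_ofReal (integral_nonneg hf0), MStrip.laplace_apply]

variable [PolishSpace S]

lemma MStrip.exists_measurable_ae_eq (h0 : ∀ k x, 0 ≤ h k x) {Ω : Type*} [MeasurableSpace Ω]
    {P : Measure Ω} {N : Ω → Measure (S × ℝ≥0)} (hN : Measurable N)
    (hfin : ∀ n, ∀ᵐ ω ∂P, ∫⁻ p, ENNReal.ofReal (stripWeight h n p) ∂N ω < ∞) :
    ∃ Y : Ω → MStrip h, Measurable Y ∧ ∀ᵐ ω ∂P, (Y ω).1 = N ω := by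
  classical
  let G : Set Ω := ⋂ n, {ω | ∫⁻ p, ENNReal.ofReal (stripWeight h n p) ∂N ω < ∞}
  have hG : MeasurableSet G := MeasurableSet.iInter fun n => measurableSet_lt
    ((Measure.measurable_lintegral
      (stripWeight h n).continuous.measurable.ennreal_ofReal).comp hN) measurable_const
  let Y (ω : Ω) : MStrip h := (MStrip.homeoBase h0).symm ⟨if ω ∈ G then N ω else 0, fun n => by
    split_ifs with hω
    · exact Set.mem_iInter.mp hω n
    · simp⟩
  refine ⟨Y, MStrip.measurable_of_measurable_val h0 (Measurable.ite hG hN measurable_const), ?_⟩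
  filter_upwards [ae_all_iff.mpr hfin] with ω hω
  exact if_pos (Set.mem_iInter.mpr hω)

lemma MStrip.integral_laplace_of_isPoissonRandomMeasure (h0 : ∀ k x, 0 ≤ h k x)
    (hpos : ∀ x, ∃ k, 0 < h k x) {Q : Measure (MStrip h)} [IsProbabilityMeasure Q] {ν : MBase h}
    (hQ : IsPoissonRandomMeasure Q (fun μ : MStrip h => μ.1) (ν.1.prod lebesgueHalfLine))
    {f : testCone (stripWeight h)} {ψ : testCone h} (hfψ : IsStripTransform f.1 ψ.1) :
    ∫ μ, MStrip.laplace h0 f μ ∂Q = MBase.laplace h0 ψ ν := by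
  have := MBase.sigmaFinite hpos ν
  have hlaplace : ∫⁻ μ, ENNReal.ofReal (MStrip.laplace h0 f μ) ∂Q
      = ENNReal.ofReal (MBase.laplace h0 ψ ν) := by
    simp only [MStrip.ofReal_laplace]
    rw [hQ.lintegral_expNeg (MStrip.measurable_val h0 hpos)
        (f := fun p => ENNReal.ofReal (f.1 p)) f.1.continuous.measurable.ennreal_ofReal,
      hfψ.lintegral_one_sub_expNeg (nonneg_of_mem_testCone (stripWeight_nonneg h0) f.2)
        (MBase.integrable_of_mem_testCone h0 ν ψ.2),
      expNeg_ofReal (integral_nonneg (nonneg_of_mem_testCone h0 ψ.2)), MBase.laplace_apply]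
  have hnonneg (μ : MStrip h) : 0 ≤ MStrip.laplace h0 f μ := (Real.exp_pos _).le
  rw [integral_eq_lintegral_of_nonneg_ae (Eventually.of_forall hnonneg)
    (MStrip.laplace h0 f).continuous.measurable.aestronglyMeasurable, hlaplace,
    ENNReal.toReal_ofReal (MBase.laplace_mem_Icc h0 ψ ν).1]

lemma MStrip.exists_isPoissonRandomMeasure (h0 : ∀ k x, 0 ≤ h k x) (hpos : ∀ x, ∃ k, 0 < h k x)
    (ν : MBase h) : ∃ Q : ProbabilityMeasure (MStrip h),
      IsPoissonRandomMeasure (Q : Measure (MStrip h)) (fun μ : MStrip h => μ.1)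
        (ν.1.prod lebesgueHalfLine) := by
  have := MBase.sigmaFinite hpos ν
  obtain ⟨Ω, _, P, N, hP, hNmeas, hN⟩ :=
    _root_.exists_isPoissonRandomMeasure (ν.1.prod lebesgueHalfLine)
  obtain ⟨Y, hY, hYN⟩ := MStrip.exists_measurable_ae_eq h0 hNmeas fun n =>
    hN.ae_lintegral_lt_top hNmeas (stripWeight h n).continuous.measurable.ennreal_ofReal
      (ν.lintegral_stripWeight_prod_ne_top h0 n)
  exact ⟨⟨P.map Y, Measure.isProbabilityMeasure_map hY.aemeasurable⟩,
    hN.map_of_ae_eq hNmeas (MStrip.measurable_val h0 hpos)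
      (MStrip.measurableSet_setOf_counting h0 hpos) hY hYN⟩

theorem exists_poissonKernel (h0 : ∀ k x, 0 ≤ h k x) (hpos : ∀ x, ∃ k, 0 < h k x) :
    ∃ κ : Kernel (MBase h) (MStrip h), IsMarkovKernel κ ∧ ∀ ν : MBase h,
      IsPoissonRandomMeasure (κ ν) (fun μ : MStrip h => μ.1) (ν.1.prod lebesgueHalfLine) := by
  choose q hq using MStrip.exists_isPoissonRandomMeasure (h := h) h0 hpos
  have := MBase.metrizableSpace h0 hpos
  have := MStrip.metrizableSpace h0 hpos
  have hcont : Continuous q := continuous_iff_continuousAt.mpr fun ν₀ =>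
    MStrip.tendsto_of_laplace h0 fun f => by
      obtain ⟨ψ, hψ⟩ := exists_isStripTransform_of_strip h0 f
      simp only [MStrip.integral_laplace_of_isPoissonRandomMeasure h0 hpos (hq _) hψ]
      exact (MBase.laplace h0 ψ).continuous.tendsto ν₀
  let _ := TopologicalSpace.metrizableSpaceMetric (MStrip h)
  have hmeas : Measurable fun ν => (q ν : Measure (MStrip h)) := by
    refine measurable_measure_of_lintegral fun g => Continuous.measurable ?_
    exact continuous_iff_continuousAt.mpr fun ν₀ =>
      ProbabilityMeasure.tendsto_iff_forall_lintegral_tendsto.mp (hcont.tendsto ν₀) g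
  exact ⟨⟨fun ν => (q ν : Measure (MStrip h)), hmeas⟩, ⟨fun ν => (q ν).2⟩, hq⟩

end PoissonStrip

section Linked

variable {S : Type*} [TopologicalSpace S] {h : ℕ → S →ᵇ ℝ}

lemma exists_antitone_isStripTransform (h0 : ∀ k x, 0 ≤ h k x) {ψ : ℕ → testCone h}
    (hψ : Antitone fun i => ⇑(ψ i).1) (hψ0 : Tendsto (fun i => ⇑(ψ i).1) atTop (𝓝 0)) :
    ∃ f : ℕ → testCone (stripWeight h), (∀ i, IsStripTransform (f i).1 (ψ i).1) ∧
      Antitone (fun i => ⇑(f i).1) ∧ Tendsto (fun i => ⇑(f i).1) atTop (𝓝 0) := by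
  obtain ⟨m, hm, hψ₀m⟩ := exists_nat_forall_two_mul_le (ψ 0).1
  have hψm (i : ℕ) (x : S) : 2 * (ψ i).1 x ≤ m :=
    (mul_le_mul_of_nonneg_left (hψ i.zero_le x) zero_le_two).trans (hψ₀m x)
  have hnonneg (i : ℕ) := nonneg_of_mem_testCone h0 (ψ i).2
  choose f hf hlog using fun i =>
    exists_isStripTransform_neg_log (ψ i).2 hm (hnonneg i) (hψm i)
  refine ⟨f, hf, fun i j hij p => ?_, tendsto_pi_nhds.mpr fun p => ?_⟩
  · have hhalf := (spread_mem_Icc hm (hnonneg i) (hψm i) p).2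
    simp only [hlog]
    exact neg_le_neg (Real.log_le_log (by linarith) (sub_le_sub_left (spread_mono (hψ hij) m p) 1))
  · have hspread : Tendsto (fun i => spread (ψ i).1 m p) atTop (𝓝 0) := by
      simpa [spread_apply] using (((tendsto_pi_nhds.mp hψ0 p.1).mul_const _).const_mul _)
    have hsub : Tendsto (fun i => 1 - spread (ψ i).1 m p) atTop (𝓝 1) := by
      simpa using hspread.const_sub 1
    simpa [hlog] using (hsub.log one_ne_zero).neg

variable [MeasurableSpace S] [BorelSpace S]

/-- The relation between the laws `Q` of a conditionally Poisson random measure and `R` of its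
directing random measure which the Laplace functionals of Poisson random measures impose. -/
def LaplaceLinked (h0 : ∀ k x, 0 ≤ h k x) (Q : ProbabilityMeasure (MStrip h))
    (R : ProbabilityMeasure (MBase h)) : Prop :=
  ∀ (f : testCone (stripWeight h)) (ψ : testCone h), IsStripTransform f.1 ψ.1 →
    ∫ μ, MStrip.laplace h0 f μ ∂(Q : Measure (MStrip h))
      = ∫ ν, MBase.laplace h0 ψ ν ∂(R : Measure (MBase h))

lemma MStrip.tendsto_integral_laplace_of_antitone (h0 : ∀ k x, 0 ≤ h k x)
    {f : ℕ → testCone (stripWeight h)} (hf : Antitone fun i => ⇑(f i).1)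
    (hf0 : Tendsto (fun i => ⇑(f i).1) atTop (𝓝 0)) (Q : ProbabilityMeasure (MStrip h)) :
    Tendsto (fun i => ∫ μ, MStrip.laplace h0 (f i) μ ∂(Q : Measure (MStrip h))) atTop (𝓝 1) := by
  simpa only [MStrip.integral_laplace_map] using
    MBase.tendsto_integral_laplace_of_antitone (stripWeight_nonneg h0) hf hf0
      (Q.map (MStrip.homeoBase h0).continuous.measurable.aemeasurable)

namespace LaplaceLinked

variable [PolishSpace S] {h0 : ∀ k x, 0 ≤ h k x}
  {Q : ℕ → ProbabilityMeasure (MStrip h)} {Q₀ : ProbabilityMeasure (MStrip h)}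
  {R : ℕ → ProbabilityMeasure (MBase h)} {R₀ : ProbabilityMeasure (MBase h)}

lemma tendsto_strip (hQR : ∀ n, LaplaceLinked h0 (Q n) (R n)) (hQR₀ : LaplaceLinked h0 Q₀ R₀)
    (hR : Tendsto R atTop (𝓝 R₀)) : Tendsto Q atTop (𝓝 Q₀) := by
  refine MStrip.tendsto_of_laplace h0 fun f => ?_
  obtain ⟨ψ, hψ⟩ := exists_isStripTransform_of_strip h0 f
  simp only [hQR _ f ψ hψ, hQR₀ f ψ hψ]
  exact ProbabilityMeasure.tendsto_iff_forall_integral_tendsto.mp hR _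

lemma tendsto_base (hQR : ∀ n, LaplaceLinked h0 (Q n) (R n)) (hQR₀ : LaplaceLinked h0 Q₀ R₀)
    (hQ : Tendsto Q atTop (𝓝 Q₀)) : Tendsto R atTop (𝓝 R₀) := by
  refine MBase.tendsto_of_laplace h0 fun ψ => ?_
  obtain ⟨f, hf⟩ := exists_isStripTransform_of_base h0 ψ
  simp only [← hQR _ f ψ hf, ← hQR₀ f ψ hf]
  exact ProbabilityMeasure.tendsto_iff_forall_integral_tendsto.mp hQ _

lemma exists_tendsto_base (hpos : ∀ x, ∃ k, 0 < h k x)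
    (hQR : ∀ n, LaplaceLinked h0 (Q n) (R n)) (hQ : Tendsto Q atTop (𝓝 Q₀)) :
    ∃ R₀, Tendsto R atTop (𝓝 R₀) := by
  have hlim {f : testCone (stripWeight h)} {ψ : testCone h} (hfψ : IsStripTransform f.1 ψ.1) :
      Tendsto (fun n => ∫ ν, MBase.laplace h0 ψ ν ∂(R n : Measure (MBase h))) atTop
        (𝓝 (∫ μ, MStrip.laplace h0 f μ ∂(Q₀ : Measure (MStrip h)))) := by
    simp only [← hQR _ f ψ hfψ]
    exact ProbabilityMeasure.tendsto_iff_forall_integral_tendsto.mp hQ _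
  choose F hF using exists_isStripTransform_of_base (h := h) h0
  refine MBase.exists_tendsto_of_laplace h0 hpos (fun ψ => hlim (hF ψ)) fun ψ hψ hψ0 => ?_
  obtain ⟨f, hf, hanti, hf0⟩ := exists_antitone_isStripTransform h0 hψ hψ0
  have hFf (i : ℕ) : ∫ μ, MStrip.laplace h0 (F (ψ i)) μ ∂(Q₀ : Measure (MStrip h))
      = ∫ μ, MStrip.laplace h0 (f i) μ ∂(Q₀ : Measure (MStrip h)) :=
    tendsto_nhds_unique (hlim (hF (ψ i))) (hlim (hf i))
  simp only [hFf]
  exact MStrip.tendsto_integral_laplace_of_antitone h0 hanti hf0 Q₀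

end LaplaceLinked

end Linked

section Cox

variable {S : Type*} [TopologicalSpace S] [MeasurableSpace S] [BorelSpace S] [PolishSpace S]
  {h : ℕ → S →ᵇ ℝ}

lemma IsConditionallyPoisson.laplaceLinked (h0 : ∀ k x, 0 ≤ h k x) (hpos : ∀ x, ∃ k, 0 < h k x)
    {Ω : Type*} [MeasurableSpace Ω] {P : Measure Ω} [IsProbabilityMeasure P] {ξ : Ω → MStrip h}
    {Ξ : Ω → MBase h} (hc : IsConditionallyPoisson P ξ Ξ) :
    LaplaceLinked h0 ⟨P.map ξ, Measure.isProbabilityMeasure_map hc.1⟩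
      ⟨P.map Ξ, Measure.isProbabilityMeasure_map hc.2.1⟩ := by
  intro f ψ hfψ
  obtain ⟨hξ, hΞ, κ, hκ, hmap, hpois⟩ := hc
  have := Measure.isProbabilityMeasure_map hΞ
  have hsnd : P.map ξ = (P.map Ξ ⊗ₘ κ).map Prod.snd := by
    rw [← hmap, AEMeasurable.map_map_of_aemeasurable measurable_snd.aemeasurable (hΞ.prodMk hξ)]
    rfl
  have hmeas : Measurable (MStrip.laplace h0 f) := (MStrip.laplace h0 f).continuous.measurable
  have hint : Integrable (fun p : MBase h × MStrip h => MStrip.laplace h0 f p.2)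
      (P.map Ξ ⊗ₘ κ) :=
    .of_bound (hmeas.comp measurable_snd).aestronglyMeasurable ‖MStrip.laplace h0 f‖
      (Eventually.of_forall fun p => (MStrip.laplace h0 f).norm_coe_le_norm p.2)
  calc ∫ μ, MStrip.laplace h0 f μ ∂P.map ξ
      = ∫ p, MStrip.laplace h0 f p.2 ∂(P.map Ξ ⊗ₘ κ) := by
        rw [hsnd, integral_map measurable_snd.aemeasurable hmeas.aestronglyMeasurable]
    _ = ∫ ν, ∫ μ, MStrip.laplace h0 f μ ∂κ ν ∂P.map Ξ := Measure.integral_compProd hint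
    _ = ∫ ν, MBase.laplace h0 ψ ν ∂P.map Ξ := integral_congr_ae <| hpois.mono fun ν hν =>
        MStrip.integral_laplace_of_isPoissonRandomMeasure h0 hpos hν hfψ

lemma IsConditionallyPoissonLaw.laplaceLinked (h0 : ∀ k x, 0 ≤ h k x)
    (hpos : ∀ x, ∃ k, 0 < h k x) {Q : ProbabilityMeasure (MStrip h)}
    {R : ProbabilityMeasure (MBase h)}
    (hc : IsConditionallyPoissonLaw (Q : Measure (MStrip h)) (R : Measure (MBase h))) :
    LaplaceLinked h0 Q R := by
  obtain ⟨ρ, hR, hQ, hρ⟩ := hc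
  have : IsProbabilityMeasure (ρ.map Prod.fst) := hR ▸ R.2
  have : IsProbabilityMeasure ρ := Measure.isProbabilityMeasure_of_map Prod.fst
  have hQ' : Q = ⟨ρ.map Prod.snd, Measure.isProbabilityMeasure_map hρ.1⟩ := Subtype.ext hQ.symm
  have hR' : R = ⟨ρ.map Prod.fst, Measure.isProbabilityMeasure_map hρ.2.1⟩ := Subtype.ext hR.symm
  rw [hQ', hR']
  exact hρ.laplaceLinked h0 hpos

lemma exists_isConditionallyPoissonLaw (h0 : ∀ k x, 0 ≤ h k x) (hpos : ∀ x, ∃ k, 0 < h k x)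
    (R : ProbabilityMeasure (MBase h)) : ∃ Q : ProbabilityMeasure (MStrip h),
      IsConditionallyPoissonLaw (Q : Measure (MStrip h)) (R : Measure (MBase h)) := by
  obtain ⟨κ, hκ, hpois⟩ := exists_poissonKernel (h := h) h0 hpos
  have hfst : ((R : Measure (MBase h)) ⊗ₘ κ).map Prod.fst = R := Measure.fst_compProd _ _
  refine ⟨⟨((R : Measure (MBase h)) ⊗ₘ κ).map Prod.snd,
    Measure.isProbabilityMeasure_map measurable_snd.aemeasurable⟩,
    (R : Measure (MBase h)) ⊗ₘ κ, hfst, rfl, measurable_snd.aemeasurable,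
    measurable_fst.aemeasurable, κ, hκ, ?_, Eventually.of_forall hpois⟩
  rw [hfst]
  exact Measure.map_id

variable {h0 : ∀ k x, 0 ≤ h k x} {Q : ℕ → ProbabilityMeasure (MStrip h)}
  {R : ℕ → ProbabilityMeasure (MBase h)} {R₀ : ProbabilityMeasure (MBase h)}

lemma LaplaceLinked.exists_tendsto_strip (hpos : ∀ x, ∃ k, 0 < h k x)
    (hQR : ∀ n, LaplaceLinked h0 (Q n) (R n)) (hR : Tendsto R atTop (𝓝 R₀)) :
    ∃ Q₀ : ProbabilityMeasure (MStrip h), Tendsto Q atTop (𝓝 Q₀) ∧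
      IsConditionallyPoissonLaw (Q₀ : Measure (MStrip h)) (R₀ : Measure (MBase h)) := by
  obtain ⟨Q₀, hQ₀⟩ := exists_isConditionallyPoissonLaw h0 hpos R₀
  exact ⟨Q₀, tendsto_strip hQR (hQ₀.laplaceLinked h0 hpos) hR, hQ₀⟩

lemma LaplaceLinked.isConditionallyPoissonLaw_of_tendsto (hpos : ∀ x, ∃ k, 0 < h k x)
    (hQR : ∀ n, LaplaceLinked h0 (Q n) (R n)) {Q₀ : ProbabilityMeasure (MStrip h)}
    (hQ : Tendsto Q atTop (𝓝 Q₀)) (hR : Tendsto R atTop (𝓝 R₀)) :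
    IsConditionallyPoissonLaw (Q₀ : Measure (MStrip h)) (R₀ : Measure (MBase h)) := by
  have := MStrip.metrizableSpace h0 hpos
  obtain ⟨Q₁, hQ₁, hcox⟩ := exists_tendsto_strip hpos hQR hR
  rwa [tendsto_nhds_unique hQ hQ₁]

end Cox

lemma exists_tendstoInDistribution_id_iff {E : Type*} [TopologicalSpace E] [MeasurableSpace E]
    [OpensMeasurableSpace E] {Ω : ℕ → Type*} [∀ n, MeasurableSpace (Ω n)]
    {P : (n : ℕ) → Measure (Ω n)} [∀ n, IsProbabilityMeasure (P n)] {X : (n : ℕ) → Ω n → E}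
    (hX : ∀ n, AEMeasurable (X n) (P n)) :
    (∃ Q : ProbabilityMeasure E, TendstoInDistribution X atTop id P (Q : Measure E)) ↔
      ∃ Q : ProbabilityMeasure E, Tendsto (β := ProbabilityMeasure E) (fun n => ⟨(P n).map (X n),
        Measure.isProbabilityMeasure_map (hX n)⟩) atTop (𝓝 Q) := by
  refine ⟨fun ⟨Q, hQ⟩ => ⟨_, hQ.tendsto⟩, fun ⟨Q, hQ⟩ => ⟨Q, hX, aemeasurable_id, ?_⟩⟩
  have hid : (⟨(Q : Measure E).map id, Measure.isProbabilityMeasure_map aemeasurable_id⟩ :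
    ProbabilityMeasure E) = Q := Subtype.ext Measure.map_id
  rwa [hid]

end

theorem mainTheorem5_general {S : Type*} [TopologicalSpace S] [PolishSpace S] [MeasurableSpace S]
    [BorelSpace S] (h : ℕ → S →ᵇ ℝ) (h_nonneg : ∀ k x, 0 ≤ h k x) (h_pos : ∀ x, ∃ k, 0 < h k x)
    {Ω : ℕ → Type*} [∀ n, MeasurableSpace (Ω n)]
    (P : (n : ℕ) → Measure (Ω n)) [∀ n, IsProbabilityMeasure (P n)]
    (ξ : (n : ℕ) → Ω n → MStrip h) (Ξ : (n : ℕ) → Ω n → MBase h)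
    (hcox : ∀ n, IsConditionallyPoisson (P n) (ξ n) (Ξ n)) :
    ((∃ Q : ProbabilityMeasure (MStrip h),
        TendstoInDistribution ξ atTop id P (Q : Measure (MStrip h))) ↔
      (∃ R : ProbabilityMeasure (MBase h),
        TendstoInDistribution Ξ atTop id P (R : Measure (MBase h)))) ∧
    (∀ {Ω₁ Ω₂ : Type*} [MeasurableSpace Ω₁] [MeasurableSpace Ω₂]
      (P₁ : Measure Ω₁) [IsProbabilityMeasure P₁] (P₂ : Measure Ω₂) [IsProbabilityMeasure P₂]
      (ξ' : Ω₁ → MStrip h) (Ξ' : Ω₂ → MBase h),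
      TendstoInDistribution ξ atTop ξ' P P₁ → TendstoInDistribution Ξ atTop Ξ' P P₂ →
        IsConditionallyPoissonLaw (P₁.map ξ') (P₂.map Ξ')) ∧
    (∀ {Ω₁ Ω₂ : Type*} [MeasurableSpace Ω₁] [MeasurableSpace Ω₂]
      (P₁ : Measure Ω₁) [IsProbabilityMeasure P₁] (P₂ : Measure Ω₂) [IsProbabilityMeasure P₂]
      (ξ' : Ω₁ → MStrip h) (Ξ' : Ω₂ → MBase h), AEMeasurable ξ' P₁ → AEMeasurable Ξ' P₂ →
      IsConditionallyPoissonLaw (P₁.map ξ') (P₂.map Ξ') →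
        (TendstoInDistribution ξ atTop ξ' P P₁ ↔ TendstoInDistribution Ξ atTop Ξ' P P₂)) := by
  have hξ (n : ℕ) : AEMeasurable (ξ n) (P n) := (hcox n).1
  have hΞ (n : ℕ) : AEMeasurable (Ξ n) (P n) := (hcox n).2.1
  have hlink := fun n => (hcox n).laplaceLinked h_nonneg h_pos
  refine ⟨?_, fun P₁ _ P₂ _ ξ' Ξ' hξ' hΞ' => ?_, fun P₁ _ P₂ _ ξ' Ξ' hξ' hΞ' hlaw => ?_⟩
  · rw [exists_tendstoInDistribution_id_iff hξ, exists_tendstoInDistribution_id_iff hΞ]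
    constructor
    · rintro ⟨Q, hQ⟩
      exact LaplaceLinked.exists_tendsto_base h_pos hlink hQ
    · rintro ⟨R, hR⟩
      exact (LaplaceLinked.exists_tendsto_strip h_pos hlink hR).imp fun _ hQ => hQ.1
  · exact LaplaceLinked.isConditionallyPoissonLaw_of_tendsto h_pos hlink hξ'.tendsto hΞ'.tendsto
  · have hlink' : LaplaceLinked h_nonneg ⟨P₁.map ξ', Measure.isProbabilityMeasure_map hξ'⟩
        ⟨P₂.map Ξ', Measure.isProbabilityMeasure_map hΞ'⟩ :=
      IsConditionallyPoissonLaw.laplaceLinked h_nonneg h_pos hlaw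
    exact ⟨fun hlim => ⟨hΞ, hΞ', LaplaceLinked.tendsto_base hlink hlink' hlim.tendsto⟩,
      fun hlim => ⟨hξ, hξ', LaplaceLinked.tendsto_strip hlink hlink' hlim.tendsto⟩⟩

theorem mainTheorem5 {S : Type*} [MetricSpace S] [CompleteSpace S]
    [TopologicalSpace.SeparableSpace S] [MeasurableSpace S] [BorelSpace S]
    (h : ℕ → S →ᵇ ℝ) (h_nonneg : ∀ k x, 0 ≤ h k x) (h_le_one : ∀ k x, h k x ≤ 1)
    (h_pos : ∀ x, ∃ k, 0 < h k x)
    {Ω : ℕ → Type*} [∀ n, MeasurableSpace (Ω n)]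
    (P : (n : ℕ) → Measure (Ω n)) [∀ n, IsProbabilityMeasure (P n)]
    (ξ : (n : ℕ) → Ω n → MStrip h) (Ξ : (n : ℕ) → Ω n → MBase h)
    (hcox : ∀ n, IsConditionallyPoisson (P n) (ξ n) (Ξ n)) :
    -- one sequence converges in distribution if and only if the other one does
    ((∃ Q : ProbabilityMeasure (MStrip h),
        TendstoInDistribution ξ atTop id P (Q : Measure (MStrip h))) ↔
      (∃ R : ProbabilityMeasure (MBase h),
        TendstoInDistribution Ξ atTop id P (R : Measure (MBase h)))) ∧
    -- the limit of `ξ n` is conditionally Poisson, with Cox measure given by the limit of `Ξ n`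
    (∀ {Ω₁ Ω₂ : Type*} [MeasurableSpace Ω₁] [MeasurableSpace Ω₂]
      (P₁ : Measure Ω₁) [IsProbabilityMeasure P₁] (P₂ : Measure Ω₂) [IsProbabilityMeasure P₂]
      (ξ' : Ω₁ → MStrip h) (Ξ' : Ω₂ → MBase h),
      TendstoInDistribution ξ atTop ξ' P P₁ → TendstoInDistribution Ξ atTop Ξ' P P₂ →
        IsConditionallyPoissonLaw (P₁.map ξ') (P₂.map Ξ')) ∧
    -- for a given conditionally Poisson `ξ'` with Cox measure `Ξ' × Λ`, the convergence of `ξ n`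
    -- to `ξ'` and that of `Ξ n` to `Ξ'` are equivalent
    (∀ {Ω₁ Ω₂ : Type*} [MeasurableSpace Ω₁] [MeasurableSpace Ω₂]
      (P₁ : Measure Ω₁) [IsProbabilityMeasure P₁] (P₂ : Measure Ω₂) [IsProbabilityMeasure P₂]
      (ξ' : Ω₁ → MStrip h) (Ξ' : Ω₂ → MBase h), AEMeasurable ξ' P₁ → AEMeasurable Ξ' P₂ →
      IsConditionallyPoissonLaw (P₁.map ξ') (P₂.map Ξ') →
        (TendstoInDistribution ξ atTop ξ' P P₁ ↔ TendstoInDistribution Ξ atTop Ξ' P P₂)) := by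
  have := UniformSpace.secondCountable_of_separable S
  exact mainTheorem5_general h h_nonneg h_pos P ξ Ξ hcox
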